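/- **Setting.** Let $M$ be a complete (connected, smooth) Riemannian manifold of dimension $n\ge 2$ and $\Omega\subsetneq M$ a $C^2$-domain. For a function $u$ let $\mathcal M(u)=(1+|\nabla u|^2)\Delta u-\nabla^2u(\nabla u,\nabla u)$. Let $H_{\partial\Omega}$ be the (normalized) mean curvature of $\partial\Omega$ with respect to the inner normal and $\partial\Omega^-=\mathrm{clos}\{p\in\partial\Omega: H_{\partial\Omega}(p)<0\}$. Let $i:M\to[0,\infty]$ be the injectivity radius function. **Hypothesis on the domain.** Let $r>0$. Assume that $\partial\Omega^-\ne\emptyset$ and that to each $p\in\partial\Omega^-$ a point $p_0=p_0(p)$ is assigned such that the closed ball of radius $r$ around $p_0$ does not meet $\Omega$, its boundary, the geodesic sphere $\Sigma_p$ of radius $r$ around $p_0$, is tangent to $\partial\Omega$ at $p$, and $r<R:=\inf\{i(p_0(p)):p\in\partial\Omega^-\}$ (the $r$-exterior-sphere condition). Put $d_p(x)=d_M(x,p_0)-r$, which is $d_M(x,\Sigma_p)$ outside the ball, and $\Sigma_{p,s}=d_p^{-1}(s)$, and let $H_{\Sigma_{p,s}}$ be the mean curvature of $\Sigma_{p,s}$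 with respect to the outward normal $\nabla d_p$. Assume moreover (locally Hadamard condition) that, for every $p\in\partial\Omega^-$, every $s\in[0,R-r)$ and every $x\in\Sigma_{p,s}\cap\Omega$, $$H_{\Sigma_p}(p)\le H_{\Sigma_{p,s}}(x),\qquad |\nabla^2d_p|(x)\le\max_{\Sigma_p}|\nabla^2d_p| ,$$ where the norm of a Hessian is its norm as a bilinear form. **Constants.** Let $\varphi\in C^2(\overline\Omega)$ and $$\mu_r=\sup_{p\in\partial\Omega^-}\max_{\Sigma_p}|\nabla^2d_p|,\quad \lambda_r=\inf_{p\in\partial\Omega^-}H_{\Sigma_p}(p),\quad \tau=\max\Big\{\sup_{\overline\Omega}|\Delta\varphi|,\ \sup_{\overline\Omega}|\nabla\varphi|,\ \sup_{\overline\Omega}|\nabla^2\varphi|\Big\}.$$ Assume $0<\tau<\infty$ and $\mu_r<\infty$ (then $\lambda_r$ is finite too; finiteness of $\tau$ and $\mu_r$ is automatic if $\Omega$ is bounded). Put $$\varrho=\tau(1+2\tau^2),\qquad \theta=\frac{2\tau^3+4\tau^2+3\tau}{\varrho}-\frac{\tau^2+2\tau+2}{\varrho}(n-1)\lambda_r+\frac{\tau^2}{\varrho}\mu_r,\qquad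 \sigma=\varrho(1-\theta),$$ $$\psi(s)=\frac1\sigma\Big[\varrho s+\frac{\sigma-\varrho}{\sigma}\big(e^{\sigma s}-1\big)\Big].$$ **Conclusion.** $\psi$ solves $\psi''-\sigma\psi'+\varrho=0$. Let $\delta<\min\{R-r,\ \frac1\sigma\ln(\frac{\varrho}{\varrho-\sigma})\}$, let $p\in\partial\Omega^-$, and set $\Lambda_{p,\delta}=B_{r+\delta}(p_0)\cap\Omega$. Then $w=\varphi+\psi\circ d_p$ belongs to $C^2(\overline{\Lambda}_{p,\delta})$, satisfies $w(p)=\varphi(p)$, and $$w(x)\ge\varphi(x)\quad\text{and}\quad \mathcal M(w)(x)\le 0\qquad\text{for all }x\in\overline{\Lambda}_{p,\delta}.$$ -/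

import Mathlib

open Set Filter Topology Manifold Bundle
open scoped ContDiff ENNReal RealInnerProductSpace

-- The model space carries its own chart; this instance is to be preferred to any other.
attribute [local instance 2000] chartedSpaceSelf

noncomputable section

namespace MinGraph

/-- The model space `ℝⁿ`. -/
abbrev Model (n : ℕ) : Type := EuclideanSpace ℝ (Fin n)

/-! ### Riemannian calculus on a smooth Riemannian manifold of dimension `n` -/

section Riemannian

variable (n : ℕ) {M : Type*} [MetricSpace M] [ChartedSpace (EuclideanSpace ℝ (Fin n)) M]

instance finiteDimensionalTangent (x : M) : FiniteDimensional ℝ (TangentSpace (𝓡 n) x) :=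
  inferInstanceAs (FiniteDimensional ℝ (EuclideanSpace ℝ (Fin n)))

/-- The coordinates of a tangent vector at `x` in the preferred chart around `x`: the identity, as
`T_x M` is by definition `ℝⁿ`, identified through that chart. -/
def coords (x : M) : TangentSpace (𝓡 n) x ≃L[ℝ] Model n :=
  ContinuousLinearEquiv.refl ℝ (Model n)

variable [RiemannianBundle (fun x : M => TangentSpace (𝓡 n) x)]

instance completeTangent (x : M) : CompleteSpace (TangentSpace (𝓡 n) x) :=
  FiniteDimensional.complete ℝ _

/-- The coefficients `g_y(u, v)` of the metric in the preferred chart around `x`: `u` and `v` are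
coordinate vectors, `y` is a point of the target of the chart. -/
def chartMetric (x : M) (y u v : Model n) : ℝ :=
  let D : Model n →L[ℝ] TangentSpace (𝓡 n) ((extChartAt (𝓡 n) x).symm y) :=
    mfderiv 𝓘(ℝ, Model n) (𝓡 n) (extChartAt (𝓡 n) x).symm y
      ∘L (NormedSpace.fromTangentSpace (𝕜 := ℝ) y).symm.toContinuousLinearMap
  ⟪D u, D v⟫

/-- The Christoffel symbols of the first kind of the Levi-Civita connection at `x`, in the preferred
chart around `x`: `Γ(u, v, w) = ½ (∂_u g(v, w) + ∂_v g(u, w) - ∂_w g(u, v))`, that is,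
`⟨∇_u V, w⟩` for the vector field `V` with constant coordinates `v`. -/
def christoffel (x : M) (u v w : Model n) : ℝ :=
  let y₀ : Model n := extChartAt (𝓡 n) x x
  (fderiv ℝ (fun y => chartMetric n x y v w) y₀ u
    + fderiv ℝ (fun y => chartMetric n x y u w) y₀ v
    - fderiv ℝ (fun y => chartMetric n x y u v) y₀ w) / 2

/-- The gradient `∇f(x)` of `f` at `x`, the derivative of `f` being taken within `s`. -/
def gradWithin (s : Set M) (f : M → ℝ) (x : M) : TangentSpace (𝓡 n) x :=
  (InnerProductSpace.toDual ℝ (TangentSpace (𝓡 n) x)).symm (mvfderivWithin (𝓡 n) f s x)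

/-- The Riemannian Hessian `∇²f(u, v)` of `f` at `x`, derivatives being taken within `s`. In the
preferred chart around `x` it is
`D²f(u, v) - df(∇_u V)`, where `V` has constant coordinates `v`, and
`df(∇_u V) = ⟨∇_u V, ∇f⟩ = Γ(u, v, ∇f)`. -/
def hessWithin (s : Set M) (f : M → ℝ) (x : M) (u v : TangentSpace (𝓡 n) x) : ℝ :=
  let F : Model n → ℝ := f ∘ (extChartAt (𝓡 n) x).symm
  let S : Set (Model n) := (extChartAt (𝓡 n) x).symm ⁻¹' s ∩ range (𝓡 n)
  let D2F : Model n →L[ℝ] Model n →L[ℝ] ℝ :=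
    fderivWithin ℝ (fderivWithin ℝ F S) S (extChartAt (𝓡 n) x x)
  D2F (coords n x u) (coords n x v)
    - christoffel n x (coords n x u) (coords n x v) (coords n x (gradWithin n s f x))

/-- The Laplacian `Δf(x)`, the trace of the Hessian. -/
def laplacianWithin (s : Set M) (f : M → ℝ) (x : M) : ℝ :=
  let e := stdOrthonormalBasis ℝ (TangentSpace (𝓡 n) x)
  ∑ i, hessWithin n s f x (e i) (e i)

/-- The norm `|∇²f|(x)` of the Hessian as a bilinear form: the supremum of `|∇²f(u, v)|` over
vectors `u`, `v` of length at most one. -/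
def hessNormWithin (s : Set M) (f : M → ℝ) (x : M) : ℝ≥0∞ :=
  ⨆ (u : TangentSpace (𝓡 n) x) (_ : ‖u‖ ≤ 1) (v : TangentSpace (𝓡 n) x) (_ : ‖v‖ ≤ 1),
    ‖hessWithin n s f x u v‖ₑ

/-- The minimal surface operator `𝓜(w) = (1 + |∇w|²) Δw - ∇²w(∇w, ∇w)`. -/
def minimalOp (s : Set M) (w : M → ℝ) (x : M) : ℝ :=
  (1 + ‖gradWithin n s w x‖ ^ 2) * laplacianWithin n s w x
    - hessWithin n s w x (gradWithin n s w x) (gradWithin n s w x)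

/-- The (normalized) mean curvature at `x` of the level hypersurface of `f` through `x`, with
respect to the unit normal `N = ∇f/|∇f|`: as `⟨-∇_X N, Y⟩ = -∇²f(X, Y)/|∇f|` for tangent `X`, `Y`,
it is `-1/((n-1)|∇f|)` times the trace of `∇²f` on the orthogonal complement of `N`. -/
def levelMeanCurvature (f : M → ℝ) (x : M) : ℝ :=
  let g : TangentSpace (𝓡 n) x := gradWithin n univ f x
  let N : TangentSpace (𝓡 n) x := ‖g‖⁻¹ • g
  (-1 / ((n - 1) * ‖g‖)) * (laplacianWithin n univ f x - hessWithin n univ f x N N)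

/-! ### Geodesics and the injectivity radius -/

/-- `γ` is a (smooth) geodesic on the open set `J` of parameters: `∇_{γ'} γ' = 0`, written at
each `t` in the preferred chart around `γ t`. -/
def IsGeodesicOn (γ : ℝ → M) (J : Set ℝ) : Prop :=
  ContMDiffOn 𝓘(ℝ, ℝ) (𝓡 n) ∞ γ J ∧
  ∀ t ∈ J,
    let c : ℝ → Model n := fun τ => extChartAt (𝓡 n) (γ t) (γ τ)
    let acc : TangentSpace (𝓡 n) (γ t) := (coords n (γ t)).symm (deriv (deriv c) t)
    ∀ w : TangentSpace (𝓡 n) (γ t),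
      ⟪acc, w⟫ + christoffel n (γ t) (deriv c t) (deriv c t) (coords n (γ t) w) = 0

/-- `e` is the Riemannian exponential map at `p` on the ball of radius `ρ` of `T_p M` (i.e.
`t ↦ e (t v)` is the geodesic starting at `p` with velocity `v`, for every `v`), and it is a
smooth diffeomorphism of that ball onto the metric ball of radius `ρ` around `p`. -/
structure IsExpDiffeo (p : M) (ρ : ℝ) (e : OpenPartialHomeomorph (TangentSpace (𝓡 n) p) M) :
    Prop where
  source_eq : e.source = Metric.ball 0 ρ
  target_eq : e.target = Metric.ball p ρ
  smooth : ContMDiffOn 𝓘(ℝ, TangentSpace (𝓡 n) p) (𝓡 n) ∞ e e.source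
  smooth_symm : ContMDiffOn (𝓡 n) 𝓘(ℝ, TangentSpace (𝓡 n) p) ∞ e.symm e.target
  map_zero : e 0 = p
  geodesic : ∀ v : TangentSpace (𝓡 n) p,
    IsGeodesicOn n (fun t : ℝ => e (t • v)) {t | t • v ∈ Metric.ball 0 ρ}
  velocity : ∀ v : TangentSpace (𝓡 n) p,
    deriv (fun t : ℝ => extChartAt (𝓡 n) p (e (t • v))) 0 = coords n p v

/-- The injectivity radius `i(p) ∈ [0, ∞]`: the supremum of the radii `ρ` such that the exponential
map at `p` is a diffeomorphism of the ball of radius `ρ` in `T_p M` onto the ball of radius `ρ`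
around `p`. -/
def injRadius (p : M) : ℝ≥0∞ :=
  ⨆ (ρ : ℝ) (_ : 0 < ρ)
    (_ : ∃ e : OpenPartialHomeomorph (TangentSpace (𝓡 n) p) M, IsExpDiffeo n p ρ e),
    ENNReal.ofReal ρ

/-! ### Domains, their mean curvature and exterior spheres -/

/-- `f` is a local `C²` defining function of `Ω` at the boundary point `p`, positive in `Ω` (so that
`∇f` is the inner normal direction). -/
structure IsDefiningAt (Ω : Set M) (p : M) (f : M → ℝ) : Prop where
  contMDiffAt : ContMDiffAt (𝓡 n) 𝓘(ℝ, ℝ) 2 f p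
  map_eq_zero : f p = 0
  deriv_ne_zero : mvfderiv (𝓡 n) f p ≠ 0
  mem_iff : ∀ᶠ x in 𝓝 p, (x ∈ Ω ↔ 0 < f x)

/-- `C²` domains: connected nonempty open sets that locally lie on one side of their
boundary, a `C²` hypersurface. -/
structure IsC2Domain (Ω : Set M) : Prop where
  isOpen : IsOpen Ω
  isConnected : IsConnected Ω
  exists_defining : ∀ p ∈ frontier Ω, ∃ f, IsDefiningAt n Ω p f

/-- `∂Ω⁻`: the closure of the set of boundary points at which the mean curvature of `∂Ω` with
respect to the inner normal is negative. (The mean curvature does not depend on the defining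
function.) -/
def negBoundary (Ω : Set M) : Set M :=
  closure {p | p ∈ frontier Ω ∧ ∃ f, IsDefiningAt n Ω p f ∧ levelMeanCurvature n f p < 0}

/-- The signed distance `d_M(·, p₀) - r` to the geodesic sphere of radius `r` around `p₀`; outside
the ball it is the distance to the sphere. -/
def sphereDist (p₀ : M) (r : ℝ) (x : M) : ℝ := dist x p₀ - r

/-- `R = inf {i(p₀)}` over the centers `p₀ = c p` of the chosen spheres, `p ∈ ∂Ω⁻`. -/
def radiusR (Ω : Set M) (c : M → M) : ℝ≥0∞ :=
  ⨅ p ∈ negBoundary n Ω, injRadius n (c p)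

/-- The exterior sphere condition of radius `r`, the sphere `Σ_p` at `p ∈ ∂Ω⁻` being the geodesic
sphere of radius `r` around `c p`: the closed ball that it bounds does not meet `Ω`, it passes
through `p`, where it is tangent to `∂Ω`, and `r < R`. -/
structure ExteriorSphere (Ω : Set M) (r : ℝ) (c : M → M) : Prop where
  nonempty : (negBoundary n Ω).Nonempty
  exterior : ∀ p ∈ negBoundary n Ω, Disjoint (Metric.closedBall (c p) r) Ω
  mem_sphere : ∀ p ∈ negBoundary n Ω, p ∈ Metric.sphere (c p) r
  tangent : ∀ p ∈ negBoundary n Ω, ∀ f, IsDefiningAt n Ω p f →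
    ∀ v : TangentSpace (𝓡 n) p,
      mvfderiv (𝓡 n) f p v = 0 ↔ mvfderiv (𝓡 n) (sphereDist (c p) r) p v = 0
  lt_radius : ENNReal.ofReal r < radiusR n Ω c

/-- `max_{Σ_p} |∇²d_p|`, where `Σ_p` has center `p₀` and radius `r`. -/
def maxHessSphere (p₀ : M) (r : ℝ) : ℝ≥0∞ :=
  ⨆ y ∈ Metric.sphere p₀ r, hessNormWithin n univ (sphereDist p₀ r) y

/-- The locally Hadamard exterior sphere condition of radius `r`. The point `x ∈ Ω` with
`d(x, c p) < R` lies on the sphere `Σ_{p,s}`, `s = d_p(x)`, whose mean curvature with respect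
to the outward normal `∇d_p` is the level mean curvature of `d_p` at `x`. -/
structure LocallyHadamardES (Ω : Set M) (r : ℝ) (c : M → M) : Prop
    extends ExteriorSphere n Ω r c where
  meanCurvature_le : ∀ p ∈ negBoundary n Ω, ∀ x ∈ Ω, edist x (c p) < radiusR n Ω c →
    levelMeanCurvature n (sphereDist (c p) r) p ≤ levelMeanCurvature n (sphereDist (c p) r) x
  hess_le : ∀ p ∈ negBoundary n Ω, ∀ x ∈ Ω, edist x (c p) < radiusR n Ω c →
    hessNormWithin n univ (sphereDist (c p) r) x ≤ maxHessSphere n (c p) r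

/-! ### The constants -/

/-- `μ_r = sup {max_{Σ_p} |∇²d_p| : p ∈ ∂Ω⁻}`. -/
def muR (Ω : Set M) (r : ℝ) (c : M → M) : ℝ≥0∞ :=
  ⨆ p ∈ negBoundary n Ω, maxHessSphere n (c p) r

/-- `λ_r = inf {H_{Σ_p}(p) : p ∈ ∂Ω⁻}`. -/
def lambdaR (Ω : Set M) (r : ℝ) (c : M → M) : EReal :=
  ⨅ p ∈ negBoundary n Ω, (levelMeanCurvature n (sphereDist (c p) r) p : EReal)

/-- `τ(φ)`, the maximum of the suprema over `closure Ω` of `|Δφ|`, `|∇φ|` and `|∇²φ|`. -/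
def tauOf (Ω : Set M) (φ : M → ℝ) : ℝ≥0∞ :=
  max (⨆ x ∈ closure Ω, ‖laplacianWithin n (closure Ω) φ x‖ₑ)
    (max (⨆ x ∈ closure Ω, ‖gradWithin n (closure Ω) φ x‖ₑ)
      (⨆ x ∈ closure Ω, hessNormWithin n (closure Ω) φ x))

end Riemannian

/-- `ϱ = τ (1 + 2τ²)`. -/
def rhoOf (τ : ℝ) : ℝ := τ * (1 + 2 * τ ^ 2)

/-- `θ = a + b (n-1) λ + c μ`, with `a = (2τ³ + 4τ² + 3τ)/ϱ`, `b = -(τ² + 2τ + 2)/ϱ`,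
`c = τ²/ϱ`. -/
def thetaOf (n : ℕ) (τ lam μ : ℝ) : ℝ :=
  let a := (2 * τ ^ 3 + 4 * τ ^ 2 + 3 * τ) / rhoOf τ
  let b := -((τ ^ 2 + 2 * τ + 2) / rhoOf τ)
  let c := τ ^ 2 / rhoOf τ
  a + b * (n - 1) * lam + c * μ

/-- `ψ(s) = (1/σ) [ϱ s + ((σ - ϱ)/σ) (e^{σ s} - 1)]`. -/
def psiOf (ϱ σ s : ℝ) : ℝ := 1 / σ * (ϱ * s + (σ - ϱ) / σ * (Real.exp (σ * s) - 1))

end MinGraph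

end

/-! Fix p and write d for the distance to the sphere at p, N = ∇d, a = ψ'(d), b = ψ''(d). The
equation for ψ is chosen to absorb the worst case of 𝓜(w).

Inside the injectivity radius the exponential map is a radial isometry, so d is smooth away from the
centre, and by the Gauss lemma |N| = 1. Differentiating |N|² = 1 gives ∇²d(N, ·) = 0. Consequently
Δd is -(n-1) times the mean curvature of the distance spheres, and since ∇w = ∇φ + aN, 𝓜(w) = (1 +
|∇w|²)(Δφ + aΔd + b) - ∇²φ(∇w, ∇w) - a∇²d(∇φ, ∇φ) - b⟨N, ∇w⟩².

Put L = -(n-1)λ. The locally Hadamard condition gives Δd ≤ L and |∇²d| ≤ μ; the data of φ are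
bounded by τ. The definition of θ amounts to σ = -(4τ² + 2τ) - (τ² + 2τ + 2)L - τ²μ. If L ≥ 0, then
σ < 0, and on the range of d considered 0 ≤ a ≤ 1 and b ≤ 0. Using |∇w| ≤ τ + a and |⟨N, ∇w⟩| ≤
|∇w|, and replacing powers of a by a, one gets 𝓜(w) ≤ ϱ - σa + b = 0 (`minimalOp_bound`).

The sign L ≥ 0 comes from the geometry: at a boundary point of negative mean curvature the exterior
sphere touches from outside and is at least as curved, so Δd > 0 there (`laplacian_sphereDist_pos`,
resting on `second_deriv_comparison`).

Two regularity matters remain. The Hadamard bounds are given in Ω but needed on its closure, so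
Hessian and Laplacian must depend continuously on the point; both are defined in a chart that
changes with the point, and `hessian_transform` brings them into a fixed one. And φ is
differentiated within the closure of Ω, where derivatives are unique because the boundary is a C²
hypersurface. -/

noncomputable section

namespace MinGraph

/-! ### Differentials and the metric in charts -/

section Bridge

variable (n : ℕ) {M : Type*} [MetricSpace M] [ChartedSpace (EuclideanSpace ℝ (Fin n)) M]

/-- The differential of a map from a normed space to `M`, the tangent vectors of `M` being
identified with their coordinates in the preferred charts. -/
def mder {V : Type*} [NormedAddCommGroup V] [NormedSpace ℝ V] (f : V → M) (v : V) :
    V →L[ℝ] Model n :=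
  (coords n (f v)).toContinuousLinearMap ∘L (mfderiv 𝓘(ℝ, V) (𝓡 n) f v
      ∘L (NormedSpace.fromTangentSpace (𝕜 := ℝ) v).symm.toContinuousLinearMap)

/-- The differential of the inverse of the preferred chart around `x`, in coordinates. -/
def frame (x : M) (y : Model n) : Model n →L[ℝ] Model n :=
  mder n (extChartAt (𝓡 n) x).symm y

section Metric

variable [RiemannianBundle (fun x : M => TangentSpace (𝓡 n) x)]

/-- The metric at `z` in the preferred chart around `z`. -/
def metricAt (z : M) : Model n →L[ℝ] Model n →L[ℝ] ℝ :=
  (innerSL ℝ (E := TangentSpace (𝓡 n) z)).bilinearComp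
    (coords n z).symm.toContinuousLinearMap (coords n z).symm.toContinuousLinearMap

theorem metricAt_apply (z : M) (u v : Model n) :
    metricAt n z u v = ⟪(coords n z).symm u, (coords n z).symm v⟫ := rfl

theorem metricAt_coords (z : M) (u v : TangentSpace (𝓡 n) z) :
    metricAt n z (coords n z u) (coords n z v) = ⟪u, v⟫ := rfl

theorem metricAt_symm (z : M) (u v : Model n) : metricAt n z u v = metricAt n z v u := by
  rw [metricAt_apply, metricAt_apply, real_inner_comm]

/-- The metric in the preferred chart around `x`, as a bilinear form. -/
def chartG (x : M) (y : Model n) : Model n →L[ℝ] Model n →L[ℝ] ℝ :=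
  (metricAt n ((extChartAt (𝓡 n) x).symm y)).bilinearComp (frame n x y) (frame n x y)

theorem chartG_apply (x : M) (y u v : Model n) :
    chartG n x y u v =
     metricAt n ((extChartAt (𝓡 n) x).symm y) (frame n x y u) (frame n x y v) := rfl

theorem chartMetric_eq (x : M) (y u v : Model n) :
    chartMetric n x y u v = chartG n x y u v := rfl

theorem chartG_symm (x : M) (y u v : Model n) : chartG n x y u v = chartG n x y v u := by
  rw [chartG_apply, chartG_apply, metricAt_symm]

end Metric

theorem extChartAt_target_mem_nhds_self (x : M) :
    (extChartAt (𝓡 n) x).target ∈ 𝓝 (extChartAt (𝓡 n) x x) :=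
  extChartAt_target_mem_nhds x

section Chain

variable {V : Type*} [NormedAddCommGroup V] [NormedSpace ℝ V]

theorem mder_comp {W : Type*} [NormedAddCommGroup W] [NormedSpace ℝ W] {f : V → M} {g : W → V}
    {w : W} (hf : MDifferentiableAt 𝓘(ℝ, V) (𝓡 n) f (g w)) (hg : DifferentiableAt ℝ g w) :
    mder n (fun w => f (g w)) w = mder n f (g w) ∘L fderiv ℝ g w := by
  have h := mfderiv_comp w hf hg.mdifferentiableAt
  rw [mfderiv_eq_fderiv] at h
  ext1 u
  exact DFunLike.congr_fun h u

theorem mder_congr {f f' : V → M} {v : V} (h : f =ᶠ[𝓝 v] f') : mder n f v = mder n f' v := by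
  have h2 := h.mfderiv_eq (I := 𝓘(ℝ, V)) (I' := 𝓡 n)
  ext1 u
  exact DFunLike.congr_fun h2 u

theorem fderiv_comp_eq_mder {f : V → M} {d : M → ℝ} {v : V}
    (hd : MDifferentiableAt (𝓡 n) 𝓘(ℝ, ℝ) d (f v)) (hf : MDifferentiableAt 𝓘(ℝ, V) (𝓡 n) f v)
    (u : V) : fderiv ℝ (fun v => d (f v)) v u
      = mvfderiv (𝓡 n) d (f v) ((coords n (f v)).symm (mder n f v u)) := by
  have h := mfderiv_comp v hd hf
  rw [mfderiv_eq_fderiv] at h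
  exact DFunLike.congr_fun h u

end Chain

variable [IsManifold (𝓡 n) ∞ M]

theorem mdifferentiableAt_extChartAt_symm {x : M} {y : Model n}
    (hy : y ∈ (extChartAt (𝓡 n) x).target) :
    MDifferentiableAt 𝓘(ℝ, Model n) (𝓡 n) (extChartAt (𝓡 n) x).symm y := by
  have := mdifferentiableWithinAt_extChartAt_symm (I := 𝓡 n) hy
  simpa [mdifferentiableWithinAt_univ] using this

/-- Tangent vectors at x are by definition coordinate vectors in the preferred chart at x, so at the
base point formulas in the chart need no change of frame. -/
theorem frame_self (x : M) : frame n x (extChartAt (𝓡 n) x x) = ContinuousLinearMap.id ℝ _ := by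
  have := mfderivWithin_range_extChartAt_symm (I := 𝓡 n) (x := x)
  simp only [modelWithCornersSelf_coe, range_id, mfderivWithin_univ] at this
  ext1 v
  exact DFunLike.congr_fun this v

section Chain

variable {V : Type*} [NormedAddCommGroup V] [NormedSpace ℝ V]

theorem differentiableAt_chart {f : V → M} {v : V} {x : M}
    (hf : MDifferentiableAt 𝓘(ℝ, V) (𝓡 n) f v) (hx : f v ∈ (extChartAt (𝓡 n) x).source) :
    DifferentiableAt ℝ (fun v => extChartAt (𝓡 n) x (f v)) v := by
  have h1 : MDifferentiableAt (𝓡 n) 𝓘(ℝ, Model n) (extChartAt (𝓡 n) x) (f v) :=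
    mdifferentiableAt_extChartAt (by simpa [extChartAt_source] using hx)
  exact (h1.comp v hf).differentiableAt

theorem mder_eq_frame_comp {f : V → M} {v : V} {x : M}
    (hf : MDifferentiableAt 𝓘(ℝ, V) (𝓡 n) f v) (hx : f v ∈ (extChartAt (𝓡 n) x).source) :
    mder n f v = frame n x (extChartAt (𝓡 n) x (f v)) ∘L
      fderiv ℝ (fun v => extChartAt (𝓡 n) x (f v)) v := by
  have h2 : f =ᶠ[𝓝 v] fun v => (extChartAt (𝓡 n) x).symm (extChartAt (𝓡 n) x (f v)) := by
    have : f ⁻¹' (extChartAt (𝓡 n) x).source ∈ 𝓝 v :=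
      hf.continuousAt.preimage_mem_nhds (extChartAt_source_mem_nhds' hx)
    filter_upwards [this] with v' hv'
    exact ((extChartAt (𝓡 n) x).left_inv hv').symm
  rw [mder_congr n h2, frame]
  exact mder_comp n (mdifferentiableAt_extChartAt_symm n ((extChartAt (𝓡 n) x).map_source hx))
    (differentiableAt_chart n hf hx)

/-- Intrinsic inner products of velocities become expressions in one fixed chart; only in this form
can they be differentiated along a curve. -/
theorem metricAt_mder [RiemannianBundle (fun x : M => TangentSpace (𝓡 n) x)] {f : V → M} {v : V}
    {x : M} (hf : MDifferentiableAt 𝓘(ℝ, V) (𝓡 n) f v) (hx : f v ∈ (extChartAt (𝓡 n) x).source)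
    (a b : V) : metricAt n (f v) (mder n f v a) (mder n f v b)
      = chartG n x (extChartAt (𝓡 n) x (f v)) (fderiv ℝ (fun v => extChartAt (𝓡 n) x (f v)) v a)
        (fderiv ℝ (fun v => extChartAt (𝓡 n) x (f v)) v b) := by
  rw [chartG_apply, (extChartAt (𝓡 n) x).left_inv hx, mder_eq_frame_comp n hf hx]
  rfl

end Chain

theorem frame_isInvertible {x : M} {y : Model n} (hy : y ∈ (extChartAt (𝓡 n) x).target) :
    (frame n x y).IsInvertible := by
  have := isInvertible_mfderivWithin_extChartAt_symm (I := 𝓡 n) hy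
  simp only [modelWithCornersSelf_coe, range_id, mfderivWithin_univ] at this
  exact this

variable [RiemannianBundle (fun x : M => TangentSpace (𝓡 n) x)]
   [IsContMDiffRiemannianBundle (𝓡 n) ∞ (EuclideanSpace ℝ (Fin n))
      (fun x : M => TangentSpace (𝓡 n) x)]

/-- The coordinate fields are the tangent map of the smooth inverse chart applied to constant
fields, hence smooth sections of the tangent bundle; their inner products are smooth because the
bundle metric is. -/
theorem contDiffOn_chartG (x : M) : ContDiffOn ℝ ∞ (chartG n x) (extChartAt (𝓡 n) x).target := by
  rw [contDiffOn_clm_apply]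
  intro u
  rw [contDiffOn_clm_apply]
  intro v
  have key : ∀ u : Model n, ContMDiffOn 𝓘(ℝ, Model n) ((𝓡 n).prod 𝓘(ℝ, Model n)) ∞
      (fun y => (⟨(extChartAt (𝓡 n) x).symm y,
        (coords n ((extChartAt (𝓡 n) x).symm y)).symm (frame n x y u)⟩ : TangentBundle (𝓡 n) M))
      (extChartAt (𝓡 n) x).target := by
    intro u
    have h1 := (contMDiffOn_extChartAt_symm (I := 𝓡 n) (n := ∞) x).contMDiffOn_tangentMapWithin
      (m := ∞) (by simp) (isOpen_extChartAt_target x).uniqueMDiffOn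
    have h2 := (contMDiff_vectorSpace_iff_contDiff (𝕜 := ℝ) (n := ∞)
      (V := fun y : Model n => (NormedSpace.fromTangentSpace (𝕜 := ℝ) y).symm u)).2 contDiff_const
    have h3 := h1.comp (h2.contMDiffOn (s := (extChartAt (𝓡 n) x).target)) (fun y hy => hy)
    refine h3.congr ?_
    intro y hy
    simp only [Function.comp_def, tangentMapWithin,
      mfderivWithin_of_isOpen (isOpen_extChartAt_target x) hy]
    rfl
  have := (key u).inner_bundle (key v)
  exact this.contDiffOn

end Bridge
end MinGraph

end

noncomputable section

namespace MinGraph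

set_option synthInstance.maxHeartbeats 400000
set_option maxHeartbeats 1000000

/-! ### The covariant Hessian in a normed space with variable metric -/

section Calculus

variable {E : Type*} [NormedAddCommGroup E] [NormedSpace ℝ E]

/-- The Christoffel symbols of the first kind of a field `G` of bilinear forms. -/
def christoffelForm (G : E → E →L[ℝ] E →L[ℝ] ℝ) (y u v w : E) : ℝ :=
  (fderiv ℝ G y u v w + fderiv ℝ G y v u w - fderiv ℝ G y w u v) / 2

theorem christoffelForm_comm {G : E → E →L[ℝ] E →L[ℝ] ℝ} {y : E}
    (hG : DifferentiableAt ℝ G y) (hs : ∀ y a b, G y a b = G y b a) (u v w : E) :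
    christoffelForm G y u v w = christoffelForm G y v u w := by
  have h : ∀ a b c, fderiv ℝ G y a b c = fderiv ℝ G y a c b := by
    intro a b c
    have h1 : HasFDerivAt (fun z => G z b c) _ y :=
      (hG.hasFDerivAt.clm_apply (hasFDerivAt_const b y)).clm_apply (hasFDerivAt_const c y)
    have h2 : HasFDerivAt (fun z => G z c b) _ y :=
      (hG.hasFDerivAt.clm_apply (hasFDerivAt_const c y)).clm_apply (hasFDerivAt_const b y)
    have h3 : (fun z => G z b c) = fun z => G z c b := by ext z; exact hs z b c
    rw [h3] at h1
    simpa using DFunLike.congr_fun (h1.unique h2) a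
  simp only [christoffelForm]
  rw [h w u v]; ring

theorem fderiv_apply_apply {F₁ F₂ : Type*} [NormedAddCommGroup F₁] [NormedSpace ℝ F₁]
    [NormedAddCommGroup F₂] [NormedSpace ℝ F₂]
    {G : E → F₁ →L[ℝ] F₂ →L[ℝ] ℝ} {y : E} {a : E → F₁} {b : E → F₂}
    {a' : E →L[ℝ] F₁} {b' : E →L[ℝ] F₂}
    {G' : E →L[ℝ] F₁ →L[ℝ] F₂ →L[ℝ] ℝ}
    (hG : HasFDerivAt (𝕜 := ℝ) (E := E) (F := F₁ →L[ℝ] F₂ →L[ℝ] ℝ) G G' y)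
    (ha : HasFDerivAt (𝕜 := ℝ) a a' y)
    (hb : HasFDerivAt (𝕜 := ℝ) b b' y) (u : E) :
    fderiv ℝ (fun z => G z (a z) (b z)) y u
      = G' u (a y) (b y) + G y (a' u) (b y) + G y (a y) (b' u) := by
  rw [((hG.clm_apply ha).clm_apply hb).fderiv]
  simp
  ring

/-- The transformation law of the covariant Hessian under a change of coordinates. -/
theorem hessian_transform {T : E → E} {y : E} (hT : ContDiffAt ℝ 2 T y)
    {G G' : E → E →L[ℝ] E →L[ℝ] ℝ} (hG : DifferentiableAt ℝ G (T y))
    (hG' : DifferentiableAt ℝ G' y) (hs : ∀ z a b, G z a b = G z b a)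
    (h : ∀ᶠ z in 𝓝 y, ∀ a b, G' z a b = G (T z) (fderiv ℝ T z a) (fderiv ℝ T z b))
    {F F' : E → ℝ} (hF : ContDiffAt ℝ 2 F (T y)) (hFF : F' =ᶠ[𝓝 y] fun z => F (T z))
    {X : E} (hX : ∀ a, G (T y) a (fderiv ℝ T y X) = fderiv ℝ F (T y) a) (u v : E) :
    fderiv ℝ (fderiv ℝ F') y u v - christoffelForm G' y u v X
      = fderiv ℝ (fderiv ℝ F) (T y) (fderiv ℝ T y u) (fderiv ℝ T y v)
        - christoffelForm G (T y) (fderiv ℝ T y u) (fderiv ℝ T y v) (fderiv ℝ T y X) := by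
  have hT1 : HasFDerivAt T (fderiv ℝ T y) y := (hT.differentiableAt (by simp)).hasFDerivAt
  have hT2 : HasFDerivAt (fderiv ℝ T) (fderiv ℝ (fderiv ℝ T) y) y :=
    ((hT.fderiv_right (m := 1) (by norm_num)).differentiableAt (by simp)).hasFDerivAt
  have hF2 : HasFDerivAt (fderiv ℝ F) (fderiv ℝ (fderiv ℝ F) (T y)) (T y) :=
    ((hF.fderiv_right (m := 1) (by norm_num)).differentiableAt (by simp)).hasFDerivAt
  have hTa : ∀ a, HasFDerivAt (fun z => fderiv ℝ T z a)
      ((fderiv ℝ (fderiv ℝ T) y).flip a) y := by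
    intro a
    have := hT2.clm_apply (hasFDerivAt_const a y)
    simpa using this
  -- Product rule for the pulled-back metric: besides the pulled-back derivative of G there are two
  -- terms with the second derivative of T.
  have key : ∀ a b c, fderiv ℝ G' y a b c
      = fderiv ℝ G (T y) (fderiv ℝ T y a) (fderiv ℝ T y b) (fderiv ℝ T y c)
        + G (T y) (fderiv ℝ (fderiv ℝ T) y a b) (fderiv ℝ T y c)
        + G (T y) (fderiv ℝ T y b) (fderiv ℝ (fderiv ℝ T) y a c) := by
    intro a b c
    have h1 := fderiv_apply_apply hG'.hasFDerivAt (hasFDerivAt_const b y) (hasFDerivAt_const c y) a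
    have hGT : HasFDerivAt (fun z => G (T z)) ((fderiv ℝ G (T y)).comp (fderiv ℝ T y)) y :=
      HasFDerivAt.comp (g := G) y hG.hasFDerivAt hT1
    have h2 := fderiv_apply_apply hGT (hTa b) (hTa c) a
    have h3 : (fun z => G' z b c) =ᶠ[𝓝 y]
        fun z => G (T z) (fderiv ℝ T z b) (fderiv ℝ T z c) := by
      filter_upwards [h] with z hz using hz b c
    rw [h3.fderiv_eq, h2] at h1
    simpa using h1.symm
  have hsym : ∀ a b, fderiv ℝ (fderiv ℝ T) y a b = fderiv ℝ (fderiv ℝ T) y b a := by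
    have := hT.isSymmSndFDerivAt (by simp)
    intro a b
    exact this.eq a b
  have hD : fderiv ℝ (fderiv ℝ F') y u v
      = fderiv ℝ (fderiv ℝ F) (T y) (fderiv ℝ T y u) (fderiv ℝ T y v)
        + fderiv ℝ F (T y) (fderiv ℝ (fderiv ℝ T) y u v) := by
    have h1 : fderiv ℝ F' =ᶠ[𝓝 y] fun z => (fderiv ℝ F (T z)).comp (fderiv ℝ T z) := by
      have e1 : ∀ᶠ z in 𝓝 y, ContDiffAt ℝ 2 T z := hT.eventually (by simp)
      have e2 : ∀ᶠ z in 𝓝 y, ContDiffAt ℝ 2 F (T z) :=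
        hT.continuousAt.eventually (hF.eventually (by simp))
      filter_upwards [hFF.eventuallyEq_nhds, e1, e2] with z hz h1 h2
      rw [hz.fderiv_eq]
      exact fderiv_comp z (h2.differentiableAt (by simp)) (h1.differentiableAt (by simp))
    have h2 : HasFDerivAt (fun z => (fderiv ℝ F (T z)).comp (fderiv ℝ T z)) _ y :=
      (hF2.comp y hT1).clm_comp hT2
    rw [h1.fderiv_eq, h2.fderiv]
    simp
    ring
  rw [hD]
  simp only [christoffelForm, key]
  -- By symmetry of D²T all its terms in the Christoffel symbols cancel but G(D²T(u, v), DT X).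
  -- Since DT X is the gradient of F, this equals dF(D²T(u, v)), the extra term of the chain rule in
  -- `hD`.
  have e1 := hX (fderiv ℝ (fderiv ℝ T) y u v)
  rw [hsym v u, hsym X u, hsym X v, hs (T y) (fderiv ℝ T y v) (fderiv ℝ (fderiv ℝ T) y u X)]
  rw [← e1]
  ring

/-- If `|dF| ≤ |·|` near `y`, with equality at `X` in `y`, then the covariant Hessian of `F`
vanishes in the direction of `X`. -/
theorem hessian_gradient_eq_zero {G : E → E →L[ℝ] E →L[ℝ] ℝ} {F : E → ℝ} {y X : E}
    (hG : DifferentiableAt ℝ G y) (hF : DifferentiableAt ℝ (fderiv ℝ F) y)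
    (hle : ∀ᶠ z in 𝓝 y, (fderiv ℝ F z X) ^ 2 ≤ G z X X)
    (h1 : fderiv ℝ F y X = 1) (hX : G y X X = 1) (u : E) :
    fderiv ℝ (fderiv ℝ F) y u X = christoffelForm G y u X X := by
  have hc := hasFDerivAt_const (𝕜 := ℝ) X y
  -- With X frozen as a constant vector, this difference is nonnegative near y and zero at y, so its
  -- differential vanishes; that is the claim.
  have hm : IsLocalMin (fun z => G z X X - (fderiv ℝ F z X) ^ 2) y := by
    filter_upwards [hle] with z hz
    rw [h1, hX]
    linarith
  have d1 := (hG.hasFDerivAt.clm_apply hc).clm_apply hc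
  have d2 := (hF.hasFDerivAt.clm_apply hc).pow 2
  have h3 := DFunLike.congr_fun (hm.hasFDerivAt_eq_zero (d1.sub d2)) u
  simp [h1] at h3
  simp only [christoffelForm]
  linarith

end Calculus

/-! ### Radial geodesics: constant speed and the Gauss computation -/

section Radial

variable {E V : Type*} [NormedAddCommGroup E] [NormedSpace ℝ E]
  [NormedAddCommGroup V] [NormedSpace ℝ V]

theorem hasDerivAt_apply_apply {F₁ F₂ : Type*} [NormedAddCommGroup F₁] [NormedSpace ℝ F₁]
    [NormedAddCommGroup F₂] [NormedSpace ℝ F₂]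
    {G : ℝ → F₁ →L[ℝ] F₂ →L[ℝ] ℝ} {t : ℝ} {a : ℝ → F₁} {b : ℝ → F₂} {a' : F₁} {b' : F₂}
    {G' : F₁ →L[ℝ] F₂ →L[ℝ] ℝ}
    (hG : HasDerivAt (𝕜 := ℝ) (F := F₁ →L[ℝ] F₂ →L[ℝ] ℝ) G G' t) (ha : HasDerivAt (𝕜 := ℝ) a a' t)
    (hb : HasDerivAt (𝕜 := ℝ) b b' t) :
    HasDerivAt (fun z => G z (a z) (b z))
      (G' (a t) (b t) + G t a' (b t) + G t (a t) b') t := by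
  have := (hG.clm_apply ha).clm_apply hb
  simpa [add_assoc] using this

variable {G : E → E →L[ℝ] E →L[ℝ] ℝ} {c : V → E} {v : V} {t : ℝ}

theorem deriv_deriv_radial (hc : ContDiffAt ℝ 2 c (t • v)) :
    deriv (fun s : ℝ => c (s • v)) t = fderiv ℝ c (t • v) v ∧
    deriv (deriv (fun s : ℝ => c (s • v))) t = fderiv ℝ (fderiv ℝ c) (t • v) v v := by
  have hl : ∀ s : ℝ, HasDerivAt (fun s : ℝ => s • v) v s := fun s => by
    simpa using (hasDerivAt_id s).smul_const v
  have hev : ∀ᶠ s in 𝓝 t, deriv (fun s : ℝ => c (s • v)) s = fderiv ℝ c (s • v) v := by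
    have : ∀ᶠ s in 𝓝 t, ContDiffAt ℝ 2 c (s • v) :=
      (hl t).continuousAt.eventually (hc.eventually (by simp))
    filter_upwards [this] with s hs
    exact ((hs.differentiableAt (by simp)).hasFDerivAt.comp_hasDerivAt s (hl s)).deriv
  refine ⟨hev.self_of_nhds, ?_⟩
  rw [EventuallyEq.deriv_eq hev]
  have h2 : HasFDerivAt (fderiv ℝ c) (fderiv ℝ (fderiv ℝ c) (t • v)) (t • v) :=
    ((hc.fderiv_right (m := 1) (by norm_num)).differentiableAt (by simp)).hasFDerivAt
  have h3 : HasDerivAt (fun s : ℝ => fderiv ℝ c (s • v)) (fderiv ℝ (fderiv ℝ c) (t • v) v) t :=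
    h2.comp_hasDerivAt t (hl t)
  have h4 := h3.clm_apply (hasDerivAt_const t v)
  simpa using h4.deriv

/-- Radial geodesics have constant speed. -/
theorem hasDerivAt_speed
    (hc : ContDiffAt ℝ 2 c (t • v)) (hG : DifferentiableAt ℝ G (c (t • v)))
    (hs : ∀ z a b, G z a b = G z b a)
    (hgeo : ∀ z, G (c (t • v)) (fderiv ℝ (fderiv ℝ c) (t • v) v v) z
      + christoffelForm G (c (t • v)) (fderiv ℝ c (t • v) v) (fderiv ℝ c (t • v) v) z = 0) :
    HasDerivAt (fun s : ℝ => G (c (s • v)) (fderiv ℝ c (s • v) v) (fderiv ℝ c (s • v) v)) 0 t := by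
  have hl : HasDerivAt (fun s : ℝ => s • v) v t := by
    simpa using (hasDerivAt_id t).smul_const v
  have h1 : HasDerivAt (fun s : ℝ => G (c (s • v)))
      (fderiv ℝ G (c (t • v)) (fderiv ℝ c (t • v) v)) t :=
    HasFDerivAt.comp_hasDerivAt (l := G) t hG.hasFDerivAt
      ((hc.differentiableAt (by simp)).hasFDerivAt.comp_hasDerivAt t hl)
  have h2 : HasFDerivAt (fderiv ℝ c) (fderiv ℝ (fderiv ℝ c) (t • v)) (t • v) :=
    ((hc.fderiv_right (m := 1) (by norm_num)).differentiableAt (by simp)).hasFDerivAt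
  have h3 : HasDerivAt (fun s : ℝ => fderiv ℝ c (s • v)) (fderiv ℝ (fderiv ℝ c) (t • v) v) t :=
    h2.comp_hasDerivAt t hl
  have h5 := h3.clm_apply (hasDerivAt_const t v)
  have h4 := hasDerivAt_apply_apply h1 h5 h5
  refine h4.congr_deriv ?_
  -- The geodesic equation tested against the velocity itself.
  have := hgeo (fderiv ℝ c (t • v) v)
  simp only [christoffelForm] at this
  simp only [map_zero, add_zero]
  rw [hs _ (fderiv ℝ c (t • v) v)]
  linarith

/-- The derivative along a radial geodesic in the Gauss lemma. -/
theorem hasDerivAt_gauss {w : V} {κ : ℝ}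
    (hc : ContDiffAt ℝ 2 c (t • v)) (hG : DifferentiableAt ℝ G (c (t • v)))
    (hs : ∀ z a b, G z a b = G z b a)
    (hgeo : ∀ z, G (c (t • v)) (fderiv ℝ (fderiv ℝ c) (t • v) v v) z
      + christoffelForm G (c (t • v)) (fderiv ℝ c (t • v) v) (fderiv ℝ c (t • v) v) z = 0)
    (hκ : HasDerivAt (fun s : ℝ => G (c (t • (v + s • w)))
      (fderiv ℝ c (t • (v + s • w)) (v + s • w)) (fderiv ℝ c (t • (v + s • w)) (v + s • w)))
      (2 * κ) 0) :
    HasDerivAt (fun s : ℝ => G (c (s • v)) (fderiv ℝ c (s • v) v)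
      (s • fderiv ℝ c (s • v) w)) κ t := by
  have hl : HasDerivAt (fun s : ℝ => s • v) v t := by
    simpa using (hasDerivAt_id t).smul_const v
  have h1 : HasDerivAt (fun s : ℝ => G (c (s • v)))
      (fderiv ℝ G (c (t • v)) (fderiv ℝ c (t • v) v)) t :=
    HasFDerivAt.comp_hasDerivAt (l := G) t hG.hasFDerivAt
      ((hc.differentiableAt (by simp)).hasFDerivAt.comp_hasDerivAt t hl)
  have h2 : HasFDerivAt (fderiv ℝ c) (fderiv ℝ (fderiv ℝ c) (t • v)) (t • v) :=
    ((hc.fderiv_right (m := 1) (by norm_num)).differentiableAt (by simp)).hasFDerivAt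
  have h3 : HasDerivAt (fun s : ℝ => fderiv ℝ c (s • v)) (fderiv ℝ (fderiv ℝ c) (t • v) v) t :=
    h2.comp_hasDerivAt t hl
  have h5 := h3.clm_apply (hasDerivAt_const t v)
  have h6 := (hasDerivAt_id t).smul (h3.clm_apply (hasDerivAt_const t w))
  have h4 := hasDerivAt_apply_apply h1 h5 h6
  -- the variation of the speed
  have hm : HasDerivAt (fun s : ℝ => v + s • w) w 0 := by
    simpa using ((hasDerivAt_id (0 : ℝ)).smul_const w).const_add v
  have hm' : HasDerivAt (fun s : ℝ => t • (v + s • w)) (t • w) 0 := hm.const_smul t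
  have k1 : HasDerivAt (fun s : ℝ => G (c (t • (v + s • w))))
      (fderiv ℝ G (c (t • v)) (fderiv ℝ c (t • v) (t • w))) 0 := by
    refine HasFDerivAt.comp_hasDerivAt (l := G) 0 ?_ (HasFDerivAt.comp_hasDerivAt (l := c) 0 ?_ hm')
    · simpa using hG.hasFDerivAt
    · simpa using (hc.differentiableAt (by simp)).hasFDerivAt
  have k2 : HasDerivAt (fun s : ℝ => fderiv ℝ c (t • (v + s • w)))
      (fderiv ℝ (fderiv ℝ c) (t • v) (t • w)) 0 := by
    refine HasFDerivAt.comp_hasDerivAt (l := fderiv ℝ c) 0 ?_ hm'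
    simpa using h2
  have k3 := k2.clm_apply hm
  have k4 := hasDerivAt_apply_apply k1 k3 k3
  have k5 := hκ.unique k4
  -- Equality of mixed derivatives plays the part of vanishing torsion: the derivative along the
  -- geodesic of the variation field is the variation of the velocity, whose pairing with the
  -- velocity is half the variation of the squared speed.
  have hsym : fderiv ℝ (fderiv ℝ c) (t • v) w v = fderiv ℝ (fderiv ℝ c) (t • v) v w :=
    (hc.isSymmSndFDerivAt (by simp)).eq w v
  refine h4.congr_deriv ?_
  have := hgeo (t • fderiv ℝ c (t • v) w)
  simp only [christoffelForm] at this
  simp only [zero_smul, add_zero, map_smul, smul_apply, hsym,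
    smul_eq_mul, map_add, add_apply] at k5 this
  simp only [Pi.smul_apply', id, map_zero, add_zero, map_add, map_smul, smul_eq_mul, one_smul]
  rw [hs _ (fderiv ℝ (fderiv ℝ c) (t • v) v w) (fderiv ℝ c (t • v) v),
    hs _ (fderiv ℝ c (t • v) w) (fderiv ℝ c (t • v) v)] at k5
  linarith

end Radial
end MinGraph

end

noncomputable section

namespace MinGraph

/-! ### Second-order comparison of two tangent hypersurfaces -/

section Comparison

/-- The second derivative test. -/
theorem eventually_pos_of_second_deriv_pos {f g : ℝ → ℝ} {m : ℝ}
    (hf : ∀ᶠ t in 𝓝 (0 : ℝ), HasDerivAt f (g t) t) (hg : HasDerivAt g m 0) (f0 : f 0 = 0)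
    (g0 : g 0 = 0) (hm : 0 < m) : ∀ᶠ t in 𝓝[>] (0 : ℝ), 0 < f t := by
  have h1 : ∀ᶠ t in 𝓝[>] (0 : ℝ), 0 < slope g 0 t := by
    have := (hasDerivAt_iff_tendsto_slope.1 hg).eventually (lt_mem_nhds hm)
    exact this.filter_mono (nhdsWithin_mono _ fun t (ht : (0 : ℝ) < t) => ht.ne')
  obtain ⟨ε, hε, h2⟩ := (mem_nhdsGT_iff_exists_Ioo_subset).1
    (h1.and (hf.filter_mono nhdsWithin_le_nhds))
  filter_upwards [Ioo_mem_nhdsGT (show (0 : ℝ) < ε from hε)] with t ht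
  have hd : ∀ s ∈ Icc 0 t, HasDerivAt f (g s) s := by
    intro s hs
    rcases hs.1.eq_or_lt with h | h
    · rw [← h]; exact hf.self_of_nhds
    · exact (h2 ⟨h, hs.2.trans_lt ht.2⟩).2
  obtain ⟨ξ, hξ, he⟩ := exists_hasDerivAt_eq_slope f g ht.1
    (fun s hs => (hd s hs).continuousAt.continuousWithinAt)
    (fun s hs => hd s ⟨hs.1.le, hs.2.le⟩)
  have h3 := (h2 ⟨hξ.1, hξ.2.trans ht.2⟩).1
  simp only [slope_def_field, g0, sub_zero] at h3
  have h4 : 0 < g ξ := (div_pos_iff_of_pos_right hξ.1).1 h3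
  rw [he, f0, sub_zero, sub_zero] at h4
  exact (div_pos_iff_of_pos_right ht.1).1 h4

variable {E : Type*} [NormedAddCommGroup E] [NormedSpace ℝ E]

/-- A function is positive along a parabola if its second derivative along it is. -/
theorem eventually_pos_parabola {F : E → ℝ} {y v z : E} (hF : ContDiffAt ℝ 2 F y)
    (F0 : F y = 0) (hv : fderiv ℝ F y v = 0)
    (h : 0 < fderiv ℝ (fderiv ℝ F) y v v + 2 * fderiv ℝ F y z) :
    ∀ᶠ t : ℝ in 𝓝[>] 0, 0 < F (y + t • v + t ^ 2 • z) := by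
  have hc : ∀ t : ℝ, HasDerivAt (fun t : ℝ => y + t • v + t ^ 2 • z) (v + (2 * t) • z) t := by
    intro t
    have h1 := ((hasDerivAt_id t).smul_const v).const_add y
    have h2 := (hasDerivAt_pow 2 t).smul_const z
    simpa using h1.fun_add h2
  have h0 : y + (0 : ℝ) • v + (0 : ℝ) ^ 2 • z = y := by simp
  have hF2 : HasFDerivAt (fderiv ℝ F) (fderiv ℝ (fderiv ℝ F) y) y :=
    ((hF.fderiv_right (m := 1) (by norm_num)).differentiableAt (by simp)).hasFDerivAt
  refine eventually_pos_of_second_deriv_pos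
    (g := fun t : ℝ => fderiv ℝ F (y + t • v + t ^ 2 • z) (v + (2 * t) • z)) ?_ ?_
    (by simpa using F0) (by simpa using hv) h
  · have : ∀ᶠ t : ℝ in 𝓝 0, ContDiffAt ℝ 2 F (y + t • v + t ^ 2 • z) := by
      refine (hc 0).continuousAt.eventually ?_
      simp only [h0]
      exact hF.eventually (by simp)
    filter_upwards [this] with t ht
    exact HasFDerivAt.comp_hasDerivAt (l := F) t
      (ht.differentiableAt (by simp)).hasFDerivAt (hc t)
  · have h1 : HasDerivAt (fun t : ℝ => fderiv ℝ F (y + t • v + t ^ 2 • z))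
        (fderiv ℝ (fderiv ℝ F) y v) 0 := by
      have := hc 0
      simp only [mul_zero, zero_smul, add_zero] at this
      refine HasFDerivAt.comp_hasDerivAt (l := fderiv ℝ F) 0 ?_ this
      simpa using hF2
    have h2 : HasDerivAt (fun t : ℝ => v + (2 * t) • z) ((2 : ℝ) • z) 0 := by
      have := (((hasDerivAt_id (0 : ℝ)).const_mul 2).smul_const z).const_add v
      simpa using this
    have h3 := h1.clm_apply h2
    refine h3.congr_deriv ?_
    simp

/-- If `{F > 0} ⊆ {D ≥ 0}` near a common zero, where the differentials of `F` and `D` have the same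
kernel, then the Hessians compare on this kernel. -/
theorem second_deriv_comparison {F D : E → ℝ} {y : E} (hF : ContDiffAt ℝ 2 F y)
    (hD : ContDiffAt ℝ 2 D y) (F0 : F y = 0) (D0 : D y = 0)
    (h : ∀ᶠ z in 𝓝 y, 0 < F z → 0 ≤ D z)
    (hker : ∀ v, fderiv ℝ F y v = 0 ↔ fderiv ℝ D y v = 0) (hne : fderiv ℝ F y ≠ 0) :
    ∃ k : ℝ, 0 < k ∧ fderiv ℝ D y = k • fderiv ℝ F y ∧ ∀ v, fderiv ℝ F y v = 0 →
      k * fderiv ℝ (fderiv ℝ F) y v v ≤ fderiv ℝ (fderiv ℝ D) y v v := by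
  obtain ⟨z', hz'⟩ : ∃ z, fderiv ℝ F y z ≠ 0 := by
    by_contra hcon
    push Not at hcon
    exact hne (ContinuousLinearMap.ext hcon)
  obtain ⟨z, hz⟩ : ∃ z, fderiv ℝ F y z = 1 :=
    ⟨(fderiv ℝ F y z')⁻¹ • z', by simp [hz']⟩
  have hpar : ∀ v a, Tendsto (fun t : ℝ => y + t • v + t ^ 2 • a) (𝓝[>] 0) (𝓝 y) := by
    intro v a
    have : Continuous (fun t : ℝ => y + t • v + t ^ 2 • a) := by fun_prop
    have h1 := this.tendsto 0
    simp only [zero_smul, add_zero, ne_eq, OfNat.ofNat_ne_zero, not_false_eq_true, zero_pow] at h1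
    exact h1.mono_left nhdsWithin_le_nhds
  -- If F has positive second derivative along the parabola y + tv + t²a, the parabola enters {F >
  -- 0}, where D ≥ 0; so the second derivative of D along it cannot be negative. The quadratic term
  -- is needed because the zero sets are curved.
  have key : ∀ v a, fderiv ℝ F y v = 0 →
      0 < fderiv ℝ (fderiv ℝ F) y v v + 2 * fderiv ℝ F y a →
      0 ≤ fderiv ℝ (fderiv ℝ D) y v v + 2 * fderiv ℝ D y a := by
    intro v a hv hpos
    by_contra hcon
    push Not at hcon
    have h1 := eventually_pos_parabola hF F0 hv hpos
    have e1 : fderiv ℝ (fun z => -D z) = fun z => -fderiv ℝ D z := by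
      ext1 z; exact fderiv_neg
    have e2 : fderiv ℝ (fun z => -fderiv ℝ D z) y = -fderiv ℝ (fderiv ℝ D) y := fderiv_neg
    have h2 := eventually_pos_parabola (F := fun z => -D z) (v := v) (z := a) hD.neg (by simp [D0])
      (by rw [e1]; simpa using (hker v).1 hv)
      (by rw [e1, e2]; simp only [neg_apply]; linarith)
    obtain ⟨t, ht1, ht2, ht3⟩ := (h1.and (h2.and ((hpar v a).eventually h))).exists
    linarith [ht3 ht1]
  -- The parabola with v = 0 and a = z enters {F > 0} transversally.
  have hk0 : 0 ≤ fderiv ℝ D y z := by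
    have := key 0 z (by simp) (by simp [hz])
    simp only [map_zero] at this
    linarith
  have hk : 0 < fderiv ℝ D y z := by
    refine hk0.lt_of_ne fun h0 => ?_
    have := (hker z).2 h0.symm
    simp [hz] at this
  refine ⟨fderiv ℝ D y z, hk, ?_, ?_⟩
  · ext1 v
    have h1 : fderiv ℝ F y (v - fderiv ℝ F y v • z) = 0 := by simp [hz]
    have h2 := (hker _).1 h1
    rw [map_sub, map_smul, smul_eq_mul] at h2
    simp only [smul_apply, smul_eq_mul]
    linarith
  · intro v hv
    refine le_of_forall_pos_le_add fun ε hε => ?_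
    -- The coefficient makes the second derivative of F along the parabola equal to ε/k > 0, with k
    -- = dD(z); multiplied by k, the excess in the conclusion for D is exactly ε.
    have h1 := key v ((-(fderiv ℝ (fderiv ℝ F) y v v) / 2 + ε / (2 * fderiv ℝ D y z)) • z) hv (by
      rw [map_smul, hz, smul_eq_mul, mul_one]
      have : 0 < ε / (2 * fderiv ℝ D y z) := by positivity
      linarith)
    rw [map_smul, smul_eq_mul] at h1
    have h3 : ε / (2 * fderiv ℝ D y z) * fderiv ℝ D y z = ε / 2 := by field_simp
    nlinarith

end Comparison
end MinGraph

end

noncomputable section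

namespace MinGraph

/-! ### The exponential map and the Gauss lemma -/

section Exponential

theorem two_le_infty : (2 : WithTop ℕ∞) ≤ ((⊤ : ℕ∞) : WithTop ℕ∞) :=
  WithTop.coe_le_coe.2 (le_top : (2 : ℕ∞) ≤ ⊤)

variable {n : ℕ} {M : Type*} [MetricSpace M] [ChartedSpace (EuclideanSpace ℝ (Fin n)) M]
  [RiemannianBundle (fun x : M => TangentSpace (𝓡 n) x)]

variable {p : M} {ρ : ℝ} {e : OpenPartialHomeomorph (TangentSpace (𝓡 n) p) M}

namespace IsExpDiffeo

theorem contMDiffAt (he : IsExpDiffeo n p ρ e) {v : TangentSpace (𝓡 n) p}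
    (hv : v ∈ Metric.ball 0 ρ) :
    ContMDiffAt 𝓘(ℝ, TangentSpace (𝓡 n) p) (𝓡 n) ∞ e v := by
  refine he.smooth.contMDiffAt ?_
  rw [he.source_eq]
  exact Metric.isOpen_ball.mem_nhds hv

theorem mdifferentiableAt (he : IsExpDiffeo n p ρ e) {v : TangentSpace (𝓡 n) p}
    (hv : v ∈ Metric.ball 0 ρ) :
    MDifferentiableAt 𝓘(ℝ, TangentSpace (𝓡 n) p) (𝓡 n) e v :=
  (he.contMDiffAt hv).mdifferentiableAt (by simp)

theorem mem_ball_smul {v : TangentSpace (𝓡 n) p} (hv : v ∈ Metric.ball 0 ρ) {t : ℝ}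
    (ht : t ∈ Icc (0 : ℝ) 1) : t • v ∈ Metric.ball (0 : TangentSpace (𝓡 n) p) ρ := by
  rw [mem_ball_zero_iff] at hv ⊢
  rw [norm_smul, Real.norm_of_nonneg ht.1]
  exact (mul_le_of_le_one_left (norm_nonneg v) ht.2).trans_lt hv

theorem eventually_mem (he : IsExpDiffeo n p ρ e) {v : TangentSpace (𝓡 n) p}
    (hv : v ∈ Metric.ball 0 ρ) :
    ∀ᶠ u in 𝓝 v, u ∈ Metric.ball 0 ρ ∧ e u ∈ (extChartAt (𝓡 n) (e v)).source :=
  (Metric.isOpen_ball.eventually_mem hv).and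
    ((he.contMDiffAt hv).continuousAt.eventually (extChartAt_source_mem_nhds (e v)))

end IsExpDiffeo

variable [IsManifold (𝓡 n) ∞ M]

theorem IsExpDiffeo.contDiffAt_chart (he : IsExpDiffeo n p ρ e) {v : TangentSpace (𝓡 n) p}
    (hv : v ∈ Metric.ball 0 ρ) {x : M} (hx : e v ∈ (extChartAt (𝓡 n) x).source) :
    ContDiffAt ℝ ∞ (fun v => extChartAt (𝓡 n) x (e v)) v := by
  have h1 : ContMDiffAt (𝓡 n) 𝓘(ℝ, Model n) ∞ (extChartAt (𝓡 n) x) (e v) :=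
    contMDiffAt_extChartAt' (by simpa [extChartAt_source] using hx)
  exact (h1.comp v (he.contMDiffAt hv)).contDiffAt


theorem chartG_self (x : M) (u v : Model n) :
    chartG n x (extChartAt (𝓡 n) x x) u v = metricAt n x u v := by
  rw [chartG_apply, frame_self, (extChartAt (𝓡 n) x).left_inv (mem_extChartAt_source x)]
  rfl

/-- The differential at 0 is the identity because radial geodesics start with the prescribed
velocity. It supplies the initial value for the constant-speed argument. -/
theorem IsExpDiffeo.mder_zero (he : IsExpDiffeo n p ρ e) (hρ : 0 < ρ) (v : TangentSpace (𝓡 n) p) :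
    mder n e 0 v = coords n p v := by
  have h0 : (0 : TangentSpace (𝓡 n) p) ∈ Metric.ball 0 ρ := by simpa using hρ
  have hs : e 0 ∈ (extChartAt (𝓡 n) p).source := by
    rw [he.map_zero]; exact mem_extChartAt_source p
  have hc : ContDiffAt ℝ 2 (fun v => extChartAt (𝓡 n) p (e v)) ((0 : ℝ) • v) := by
    rw [zero_smul]
    exact (he.contDiffAt_chart h0 hs).of_le two_le_infty
  have h1 := (deriv_deriv_radial hc).1
  rw [zero_smul] at h1
  rw [mder_eq_frame_comp n (he.mdifferentiableAt h0) hs, he.map_zero, frame_self,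
    ← he.velocity v, h1]
  rfl

variable [IsContMDiffRiemannianBundle (𝓡 n) ∞ (EuclideanSpace ℝ (Fin n))
      (fun x : M => TangentSpace (𝓡 n) x)]

theorem contDiffAt_chartG {x : M} {y : Model n} (hy : y ∈ (extChartAt (𝓡 n) x).target) :
    ContDiffAt ℝ ∞ (chartG n x) y :=
  (contDiffOn_chartG n x).contDiffAt ((isOpen_extChartAt_target x).mem_nhds hy)

theorem differentiableAt_chartG {x : M} {y : Model n} (hy : y ∈ (extChartAt (𝓡 n) x).target) :
    DifferentiableAt ℝ (chartG n x) y :=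
  (contDiffAt_chartG hy).differentiableAt (by simp)

theorem fderiv_chartMetric {x : M} {y : Model n} (hy : y ∈ (extChartAt (𝓡 n) x).target)
    (u v w : Model n) :
    fderiv ℝ (fun y => chartMetric n x y v w) y u = fderiv ℝ (chartG n x) y u v w := by
  have h := fderiv_apply_apply (differentiableAt_chartG hy).hasFDerivAt
    (hasFDerivAt_const v y) (hasFDerivAt_const w y) u
  simpa [chartMetric_eq] using h

theorem christoffel_eq (x : M) (u v w : Model n) :
    christoffel n x u v w = christoffelForm (chartG n x) (extChartAt (𝓡 n) x x) u v w := by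
  have hy := (extChartAt (𝓡 n) x).map_source (mem_extChartAt_source (I := 𝓡 n) x)
  simp only [christoffel, christoffelForm, fderiv_chartMetric hy]

namespace IsExpDiffeo

theorem geodesic_chart (he : IsExpDiffeo n p ρ e) {v : TangentSpace (𝓡 n) p} {t : ℝ}
    (hv : t • v ∈ Metric.ball 0 ρ) (z : Model n) :
    let c : TangentSpace (𝓡 n) p → Model n := fun u => extChartAt (𝓡 n) (e (t • v)) (e u)
    chartG n (e (t • v)) (c (t • v)) (fderiv ℝ (fderiv ℝ c) (t • v) v v) z
     + christoffelForm (chartG n (e (t • v))) (c (t • v)) (fderiv ℝ c (t • v) v)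
        (fderiv ℝ c (t • v) v) z = 0 := by
  intro c
  have hc : ContDiffAt ℝ 2 c (t • v) := ContDiffAt.of_le
    (he.contDiffAt_chart hv (mem_extChartAt_source (I := 𝓡 n) (e (t • v)))) two_le_infty
  obtain ⟨h1, h2⟩ := deriv_deriv_radial hc
  have h3 := (he.geodesic v).2 t hv ((coords n (e (t • v))).symm z)
  simp only [] at h3
  rw [chartG_self, ← h1, ← h2, metricAt_apply, ← christoffel_eq]
  exact h3

theorem hasDerivAt_speed (he : IsExpDiffeo n p ρ e) {v : TangentSpace (𝓡 n) p} {t : ℝ}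
    (hv : t • v ∈ Metric.ball 0 ρ) :
    HasDerivAt (fun s : ℝ => metricAt n (e (s • v)) (mder n e (s • v) v) (mder n e (s • v) v))
      0 t := by
  have hs := mem_extChartAt_source (I := 𝓡 n) (e (t • v))
  have hc : ContDiffAt ℝ 2 (fun u => extChartAt (𝓡 n) (e (t • v)) (e u)) (t • v) :=
    ContDiffAt.of_le (he.contDiffAt_chart hv hs) two_le_infty
  have h1 := MinGraph.hasDerivAt_speed (G := chartG n (e (t • v))) hc
    (differentiableAt_chartG ((extChartAt (𝓡 n) (e (t • v))).map_source hs))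
    (chartG_symm n (e (t • v))) (he.geodesic_chart hv)
  refine h1.congr_of_eventuallyEq ?_
  have hcont : Continuous fun s : ℝ => s • v := by fun_prop
  filter_upwards [hcont.continuousAt.eventually (he.eventually_mem hv)] with s hs
  rw [metricAt_mder n (he.mdifferentiableAt hs.1) hs.2]

/-- Radial geodesics have constant speed. -/
theorem speed (he : IsExpDiffeo n p ρ e) {v : TangentSpace (𝓡 n) p}
    (hv : v ∈ Metric.ball 0 ρ) {t : ℝ} (ht : t ∈ Icc (0 : ℝ) 1) :
    metricAt n (e (t • v)) (mder n e (t • v) v) (mder n e (t • v) v) = ⟪v, v⟫ := by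
  have hρ : 0 < ρ := (norm_nonneg v).trans_lt (mem_ball_zero_iff.1 hv)
  have hd := fun s (hs : s ∈ Icc (0 : ℝ) 1) => he.hasDerivAt_speed (mem_ball_smul hv hs)
  have h1 := constant_of_has_deriv_right_zero (a := (0 : ℝ)) (b := 1)
    (fun s hs => (hd s hs).continuousAt.continuousWithinAt)
    (fun s hs => (hd s (Ico_subset_Icc_self hs)).hasDerivWithinAt) t ht
  rw [h1, zero_smul, he.mder_zero hρ, he.map_zero, metricAt_coords]

/-- Every radial geodesic near v has squared speed equal to that of its initial vector, so the
variation of the squared speed in the direction w is 2⟨v, w⟩, whatever t is. -/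
theorem hasDerivAt_gauss (he : IsExpDiffeo n p ρ e) {v : TangentSpace (𝓡 n) p}
    (hv : v ∈ Metric.ball 0 ρ) (w : TangentSpace (𝓡 n) p) {t : ℝ} (ht : t ∈ Icc (0 : ℝ) 1) :
    HasDerivAt (fun s : ℝ => metricAt n (e (s • v)) (mder n e (s • v) v)
      (s • mder n e (s • v) w)) ⟪v, w⟫ t := by
  have htv := mem_ball_smul hv ht
  have hs := mem_extChartAt_source (I := 𝓡 n) (e (t • v))
  have hvar : HasDerivAt (fun s : ℝ => ⟪v + s • w, v + s • w⟫) (2 * ⟪v, w⟫) 0 := by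
    have hm : HasDerivAt (fun s : ℝ => v + s • w) w 0 := by
      simpa using ((hasDerivAt_id (0 : ℝ)).smul_const w).const_add v
    have := hm.inner ℝ hm
    simp only [zero_smul, add_zero] at this
    rw [real_inner_comm v w, ← two_mul] at this
    exact this
  have hc : ContDiffAt ℝ 2 (fun u => extChartAt (𝓡 n) (e (t • v)) (e u)) (t • v) :=
    ContDiffAt.of_le (he.contDiffAt_chart htv hs) two_le_infty
  have h1 := MinGraph.hasDerivAt_gauss (G := chartG n (e (t • v))) hc
    (differentiableAt_chartG ((extChartAt (𝓡 n) (e (t • v))).map_source hs))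
    (chartG_symm n (e (t • v))) (he.geodesic_chart htv) (w := w) (κ := ⟪v, w⟫) (by
      refine hvar.congr_of_eventuallyEq ?_
      have c1 : Tendsto (fun s : ℝ => v + s • w) (𝓝 0) (𝓝 v) := by
        have : Continuous (fun s : ℝ => v + s • w) := by fun_prop
        simpa using this.tendsto 0
      have a1 := c1.eventually (Metric.isOpen_ball.eventually_mem hv)
      have a2 := (c1.const_smul t).eventually (he.eventually_mem htv)
      filter_upwards [a1, a2] with s h1 h2
      rw [← metricAt_mder n (he.mdifferentiableAt h2.1) h2.2]
      exact he.speed h1 ht)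
  refine h1.congr_of_eventuallyEq ?_
  have hcont : Continuous fun s : ℝ => s • v := by fun_prop
  filter_upwards [hcont.continuousAt.eventually (he.eventually_mem htv)] with s hs
  rw [← map_smul, ← map_smul, metricAt_mder n (he.mdifferentiableAt hs.1) hs.2]

/-- The Gauss lemma. -/
theorem gauss (he : IsExpDiffeo n p ρ e) {v : TangentSpace (𝓡 n) p}
    (hv : v ∈ Metric.ball 0 ρ) (w : TangentSpace (𝓡 n) p) :
    metricAt n (e v) (mder n e v v) (mder n e v w) = ⟪v, w⟫ := by
  -- The pairing minus s⟨v, w⟩ has derivative zero and vanishes at s = 0; the lemma is its value at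
  -- s = 1.
  have hd := fun s (hs : s ∈ Icc (0 : ℝ) 1) =>
    (he.hasDerivAt_gauss hv w hs).sub ((hasDerivAt_id s).mul_const ⟪v, w⟫)
  simp only [one_mul, sub_self] at hd
  have h1 := constant_of_has_deriv_right_zero (a := (0 : ℝ)) (b := 1)
    (fun s hs => (hd s hs).continuousAt.continuousWithinAt)
    (fun s hs => (hd s (Ico_subset_Icc_self hs)).hasDerivWithinAt) 1 (by simp)
  simp at h1
  linarith

end IsExpDiffeo

end Exponential
end MinGraph

end

noncomputable section

namespace MinGraph

/-! ### The exponential map as a radial isometry -/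

section Distance

variable {n : ℕ} {M : Type*} [MetricSpace M] [ChartedSpace (EuclideanSpace ℝ (Fin n)) M]

theorem mfderiv_one_eq (γ : ℝ → M) (t : ℝ) :
    mfderiv 𝓘(ℝ, ℝ) (𝓡 n) γ t 1 = (coords n (γ t)).symm (mder n γ t 1) := rfl

variable [RiemannianBundle (fun x : M => TangentSpace (𝓡 n) x)]

theorem metricAt_self (z : M) (u : Model n) :
    metricAt n z u u = ‖(coords n z).symm u‖ ^ 2 := by
  rw [metricAt_apply, real_inner_self_eq_norm_sq]

theorem abs_metricAt_le (z : M) (u v : Model n) :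
    |metricAt n z u v| ≤ ‖(coords n z).symm u‖ * ‖(coords n z).symm v‖ := by
  rw [metricAt_apply]
  exact abs_real_inner_le_norm _ _

theorem enorm_mfderiv_one (γ : ℝ → M) (t : ℝ) :
    ‖mfderiv 𝓘(ℝ, ℝ) (𝓡 n) γ t 1‖ₑ
      = ENNReal.ofReal √(metricAt n (γ t) (mder n γ t 1) (mder n γ t 1)) := by
  rw [metricAt_self, Real.sqrt_sq (norm_nonneg _), mfderiv_one_eq, ofReal_norm]

variable {p : M} {ρ : ℝ} {e : OpenPartialHomeomorph (TangentSpace (𝓡 n) p) M}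

namespace IsExpDiffeo

variable [IsManifold (𝓡 n) ∞ M] [IsContMDiffRiemannianBundle (𝓡 n) ∞ (EuclideanSpace ℝ (Fin n))
      (fun x : M => TangentSpace (𝓡 n) x)]

theorem norm_speed (he : IsExpDiffeo n p ρ e) {v : TangentSpace (𝓡 n) p}
    (hv : v ∈ Metric.ball 0 ρ) {t : ℝ} (ht : t ∈ Icc (0 : ℝ) 1) :
    ‖(coords n (e (t • v))).symm (mder n e (t • v) v)‖ = ‖v‖ := by
  have h := he.speed hv ht
  rw [metricAt_self, real_inner_self_eq_norm_sq] at h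
  exact (sq_eq_sq₀ (norm_nonneg _) (norm_nonneg _)).1 h

/-- The length of a curve is at least the increase of the radial coordinate. -/
theorem le_pathELength (he : IsExpDiffeo n p ρ e) {γ : ℝ → M}
    (hγ : ContMDiffOn 𝓘(ℝ, ℝ) (𝓡 n) 1 γ (Icc 0 1)) (hmem : ∀ t ∈ Icc (0 : ℝ) 1, γ t ∈ e.target)
    (h0 : γ 0 = p) {ε : ℝ} (hε : 0 < ε) :
    ENNReal.ofReal (√(ε + ‖e.symm (γ 1)‖ ^ 2) - √ε) ≤ pathELength (𝓡 n) γ 0 1 := by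
  set η : ℝ → TangentSpace (𝓡 n) p := fun t => e.symm (γ t) with hη
  have hη1 : ContDiffOn ℝ 1 η (Icc 0 1) := by
    have h1 : ContMDiffOn (𝓡 n) 𝓘(ℝ, TangentSpace (𝓡 n) p) 1 e.symm e.target :=
      ContMDiffOn.of_le he.smooth_symm (by simp)
    exact (h1.comp hγ hmem).contDiffOn
  -- The radial coordinate is not differentiable at the centre, where the curve starts; the
  -- regularization by ε makes it so.
  set h : ℝ → ℝ := fun t => √(ε + ‖η t‖ ^ 2) with hh
  have hpos : ∀ t, 0 < ε + ‖η t‖ ^ 2 := fun t => by positivity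
  have hh1 : ContDiffOn ℝ 1 h (Icc 0 1) :=
    (contDiffOn_const.add (hη1.norm_sq ℝ)).sqrt fun t _ => (hpos t).ne'
  have key := enorm_sub_le_lintegral_derivWithin_Icc_of_contDiffOn_Icc hh1 zero_le_one
  have e0 : η 0 = 0 := by
    simp only [hη, h0]
    rw [← he.map_zero]
    refine e.left_inv ?_
    have := hmem 0 (by simp)
    rw [h0, he.target_eq] at this
    rw [he.source_eq]
    simpa using this
  have e1 : h 0 = √ε := by simp [hh, e0]
  rw [e1] at key
  have e2 : ENNReal.ofReal (h 1 - √ε) ≤ ‖h 1 - √ε‖ₑ := by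
    rw [← ofReal_norm]
    exact ENNReal.ofReal_le_ofReal (le_abs_self _)
  refine e2.trans (key.trans ?_)
  rw [pathELength_eq_lintegral_mfderiv_Ioo, ← MeasureTheory.restrict_Ioo_eq_restrict_Icc]
  refine MeasureTheory.setLIntegral_mono' measurableSet_Ioo fun t ht => ?_
  have hnh : Icc (0 : ℝ) 1 ∈ 𝓝 t := Icc_mem_nhds ht.1 ht.2
  have ht' := Ioo_subset_Icc_self ht
  have hηd : HasDerivAt η (deriv η t) t :=
    ((hη1.contDiffAt hnh).differentiableAt (by simp)).hasDerivAt
  have hb : η t ∈ Metric.ball 0 ρ := by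
    rw [← he.source_eq]
    exact e.map_target (hmem t ht')
  have hγη : γ =ᶠ[𝓝 t] fun s => e (η s) := by
    filter_upwards [hnh] with s hs
    exact (e.right_inv (hmem s hs)).symm
  rw [derivWithin_of_mem_nhds hnh, enorm_mfderiv_one, mder_congr n hγη, hγη.self_of_nhds,
    mder_comp n (f := e) (g := η) (he.mdifferentiableAt hb) hηd.differentiableAt,
    ContinuousLinearMap.comp_apply, fderiv_apply_one_eq_deriv, metricAt_self,
    Real.sqrt_sq (norm_nonneg _)]
  have hhd : HasDerivAt h ((2 * ⟪η t, deriv η t⟫) / (2 * √(ε + ‖η t‖ ^ 2))) t :=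
    HasDerivAt.sqrt (hηd.norm_sq.const_add ε) (hpos t).ne'
  rw [hhd.deriv, ← ofReal_norm]
  refine ENNReal.ofReal_le_ofReal ?_
  have hsq : 0 < √(ε + ‖η t‖ ^ 2) := Real.sqrt_pos.2 (hpos t)
  -- By the Gauss lemma ⟨η, η'⟩ is the inner product of the radial vector, of length |η|, with the
  -- velocity of γ. Cauchy–Schwarz then gives |h'| ≤ |γ'|, as |η| ≤ √(ε + |η|²).
  rw [mul_div_mul_left _ _ two_ne_zero, Real.norm_eq_abs, abs_div, abs_of_pos hsq,
    div_le_iff₀ hsq, ← he.gauss hb]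
  refine (abs_metricAt_le _ _ _).trans ?_
  have hsp := he.norm_speed hb (t := 1) (by simp)
  rw [one_smul] at hsp
  rw [hsp, mul_comm]
  refine mul_le_mul_of_nonneg_left ?_ (norm_nonneg _)
  exact Real.le_sqrt_of_sq_le (by linarith)

variable [IsRiemannianManifold (𝓡 n) M]

/-- The radial geodesic from p has constant speed |v| on [0, 1], hence length |v|. -/
theorem edist_le (he : IsExpDiffeo n p ρ e) {v : TangentSpace (𝓡 n) p}
    (hv : v ∈ Metric.ball 0 ρ) : edist p (e v) ≤ ENNReal.ofReal ‖v‖ := by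
  have hγ : ContMDiffOn 𝓘(ℝ, ℝ) (𝓡 n) 1 (fun t : ℝ => e (t • v)) (Icc 0 1) := by
    intro t ht
    have h1 : ContMDiffAt 𝓘(ℝ, TangentSpace (𝓡 n) p) (𝓡 n) 1 e (t • v) :=
      ContMDiffAt.of_le (he.contMDiffAt (mem_ball_smul hv ht)) (by simp)
    have h2 : ContMDiffAt 𝓘(ℝ, ℝ) 𝓘(ℝ, TangentSpace (𝓡 n) p) 1 (fun t : ℝ => t • v) t := by
      apply ContDiffAt.contMDiffAt
      fun_prop
    exact (h1.comp t h2).contMDiffWithinAt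
  rw [IsRiemannianManifold.out (I := 𝓡 n) p (e v)]
  refine (riemannianEDist_le_pathELength (I := 𝓡 n) (γ := fun t : ℝ => e (t • v)) hγ
    (by simp [he.map_zero]) (by simp) zero_le_one).trans ?_
  rw [pathELength_eq_lintegral_mfderiv_Ioo]
  have h3 : ∀ t ∈ Ioo (0 : ℝ) 1,
      ‖mfderiv 𝓘(ℝ, ℝ) (𝓡 n) (fun t : ℝ => e (t • v)) t 1‖ₑ = ENNReal.ofReal ‖v‖ := by
    intro t ht
    have ht' := Ioo_subset_Icc_self ht
    have hl : HasDerivAt (fun s : ℝ => s • v) v t := by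
      simpa using (hasDerivAt_id t).smul_const v
    rw [mfderiv_one_eq, mder_comp n (f := e) (g := fun t : ℝ => t • v)
      (he.mdifferentiableAt (mem_ball_smul hv ht')) hl.differentiableAt, ← he.norm_speed hv ht']
    simp only [ContinuousLinearMap.comp_apply, fderiv_apply_one_eq_deriv, hl.deriv]
    rw [← ofReal_norm]
  rw [MeasureTheory.setLIntegral_congr_fun measurableSet_Ioo h3]
  simp

/-- The exponential map is a radial isometry. -/
theorem dist_eq (he : IsExpDiffeo n p ρ e) {v : TangentSpace (𝓡 n) p}
    (hv : v ∈ Metric.ball 0 ρ) : dist (e v) p = ‖v‖ := by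
  have hle : dist p (e v) ≤ ‖v‖ := by
    rw [← ENNReal.ofReal_le_ofReal_iff (norm_nonneg v), ← edist_dist]
    exact he.edist_le hv
  rw [dist_comm]
  refine le_antisymm hle ?_
  by_contra hlt
  push Not at hlt
  obtain ⟨L, hL1, hL2⟩ := exists_between hlt
  have hL0 : 0 ≤ L := dist_nonneg.trans hL1.le
  have hLρ : L < ρ := hL2.trans (mem_ball_zero_iff.1 hv)
  have h1 : riemannianEDist (𝓡 n) p (e v) < ENNReal.ofReal L := by
    rw [← IsRiemannianManifold.out (I := 𝓡 n) p (e v), edist_dist]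
    exact (ENNReal.ofReal_lt_ofReal_iff_of_nonneg dist_nonneg).2 hL1
  obtain ⟨γ, h0, h2, hγ, hlen⟩ := exists_lt_of_riemannianEDist_lt h1
  -- A curve from p of length less than L < ρ cannot leave the ball of radius ρ, so the radial
  -- length estimate applies to it.
  have hmem : ∀ t ∈ Icc (0 : ℝ) 1, γ t ∈ e.target := by
    intro t ht
    rw [he.target_eq, Metric.mem_ball, dist_comm]
    have h3 : edist p (γ t) ≤ pathELength (𝓡 n) γ 0 1 := by
      rw [IsRiemannianManifold.out (I := 𝓡 n) p (γ t)]
      exact (riemannianEDist_le_pathELength (hγ.mono (Icc_subset_Icc_right ht.2)) h0 rfl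
        ht.1).trans (pathELength_mono le_rfl ht.2)
    have h4 := h3.trans_lt hlen
    rw [edist_dist, ENNReal.ofReal_lt_ofReal_iff_of_nonneg dist_nonneg] at h4
    exact h4.trans hLρ
  have h5 : ∀ ε : ℝ, 0 < ε → √(ε + ‖v‖ ^ 2) - √ε ≤ L := by
    intro ε hε
    have := (he.le_pathELength hγ hmem h0 hε).trans hlen.le
    rw [h2, e.left_inv (by rw [he.source_eq]; exact hv), ENNReal.ofReal_le_ofReal_iff hL0] at this
    exact this
  have h6 : Tendsto (fun ε : ℝ => √(ε + ‖v‖ ^ 2) - √ε) (𝓝[>] 0) (𝓝 ‖v‖) := by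
    have : Continuous (fun ε : ℝ => √(ε + ‖v‖ ^ 2) - √ε) := by fun_prop
    have h7 := this.tendsto 0
    simp only [zero_add, Real.sqrt_zero, sub_zero, Real.sqrt_sq (norm_nonneg v)] at h7
    exact h7.mono_left nhdsWithin_le_nhds
  have h8 := le_of_tendsto h6 (eventually_mem_nhdsWithin.mono fun ε hε => h5 ε hε)
  linarith

end IsExpDiffeo
end Distance
end MinGraph

end

noncomputable section

namespace MinGraph

/-! ### Functions read in charts -/

section Chart

variable {n : ℕ} {M : Type*} [MetricSpace M] [ChartedSpace (EuclideanSpace ℝ (Fin n)) M]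
  [IsManifold (𝓡 n) ∞ M]

theorem contDiffAt_comp_symm {f : M → ℝ} {x : M} {y : Model n}
    {k : WithTop ℕ∞} (hk : k ≤ ((⊤ : ℕ∞) : WithTop ℕ∞))
    (hy : y ∈ (extChartAt (𝓡 n) x).target)
    (hf : ContMDiffAt (𝓡 n) 𝓘(ℝ, ℝ) k f ((extChartAt (𝓡 n) x).symm y)) :
    ContDiffAt ℝ k (fun y => f ((extChartAt (𝓡 n) x).symm y)) y := by
  have h1 : ContMDiffAt 𝓘(ℝ, Model n) (𝓡 n) k (extChartAt (𝓡 n) x).symm y :=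
    ContMDiffAt.of_le ((contMDiffOn_extChartAt_symm (I := 𝓡 n) (n := ∞) x).contMDiffAt
      ((isOpen_extChartAt_target x).mem_nhds hy)) hk
  exact (hf.comp y h1).contDiffAt

end Chart

/-! ### Gradient and Hessian; functions with unit gradient -/

section Gradient

variable {n : ℕ} {M : Type*} [MetricSpace M] [ChartedSpace (EuclideanSpace ℝ (Fin n)) M]
  [RiemannianBundle (fun x : M => TangentSpace (𝓡 n) x)]

theorem inner_gradWithin (s : Set M) (f : M → ℝ) (x : M) (u : TangentSpace (𝓡 n) x) :
    ⟪gradWithin n s f x, u⟫ = mvfderivWithin (𝓡 n) f s x u := by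
  rw [gradWithin, InnerProductSpace.toDual_symm_apply]

theorem inner_grad (f : M → ℝ) (x : M) (u : TangentSpace (𝓡 n) x) :
    ⟪gradWithin n univ f x, u⟫ = mvfderiv (𝓡 n) f x u := by
  rw [inner_gradWithin, mvfderivWithin_univ]

variable [IsManifold (𝓡 n) ∞ M]

theorem fderiv_comp_symm {f : M → ℝ} {x : M} {y : Model n}
    (hy : y ∈ (extChartAt (𝓡 n) x).target)
    (hf : MDifferentiableAt (𝓡 n) 𝓘(ℝ, ℝ) f ((extChartAt (𝓡 n) x).symm y)) (u : Model n) :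
    fderiv ℝ (fun y => f ((extChartAt (𝓡 n) x).symm y)) y u
      = metricAt n ((extChartAt (𝓡 n) x).symm y)
        (coords n _ (gradWithin n univ f ((extChartAt (𝓡 n) x).symm y))) (frame n x y u) := by
  rw [fderiv_comp_eq_mder n hf (mdifferentiableAt_extChartAt_symm n hy), ← inner_grad]
  rfl

theorem hessWithin_univ_eq (f : M → ℝ) (x : M) (u v : TangentSpace (𝓡 n) x) :
    hessWithin n univ f x u v
      = fderiv ℝ (fderiv ℝ (fun y => f ((extChartAt (𝓡 n) x).symm y))) (extChartAt (𝓡 n) x x)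
          (coords n x u) (coords n x v)
        - christoffel n x (coords n x u) (coords n x v) (coords n x (gradWithin n univ f x)) := by
  have h : (extChartAt (𝓡 n) x).symm ⁻¹' univ ∩ range (𝓡 n) = univ := by simp
  simp only [hessWithin, h, fderivWithin_univ]
  rfl

variable [IsContMDiffRiemannianBundle (𝓡 n) ∞ (EuclideanSpace ℝ (Fin n))
      (fun x : M => TangentSpace (𝓡 n) x)]

theorem christoffel_comm (x : M) (u v w : Model n) :
    christoffel n x u v w = christoffel n x v u w := by
  rw [christoffel_eq, christoffel_eq, christoffelForm_comm _ (chartG_symm n x)]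
  exact differentiableAt_chartG (extChartAt_target_mem_nhds_self n x |> mem_of_mem_nhds)

theorem hess_symm {f : M → ℝ} {x : M} (hf : ContMDiffAt (𝓡 n) 𝓘(ℝ, ℝ) 2 f x)
    (u v : TangentSpace (𝓡 n) x) : hessWithin n univ f x u v = hessWithin n univ f x v u := by
  have hy : extChartAt (𝓡 n) x x ∈ (extChartAt (𝓡 n) x).target := mem_extChartAt_target x
  have h1 : ContDiffAt ℝ 2 (fun y => f ((extChartAt (𝓡 n) x).symm y)) (extChartAt (𝓡 n) x x) :=
    contDiffAt_comp_symm two_le_infty hy (by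
      rwa [(extChartAt (𝓡 n) x).left_inv (mem_extChartAt_source x)])
  rw [hessWithin_univ_eq, hessWithin_univ_eq, christoffel_comm,
    (h1.isSymmSndFDerivAt (by simp)).eq]

/-- The Hessian of a function with unit gradient vanishes in the direction of the gradient. -/
theorem hess_grad_eq_zero {f : M → ℝ} {x : M} (hf : ContMDiffAt (𝓡 n) 𝓘(ℝ, ℝ) 2 f x)
    (hg : ∀ᶠ y in 𝓝 x, ‖gradWithin n univ f y‖ = 1) (u : TangentSpace (𝓡 n) x) :
    hessWithin n univ f x u (gradWithin n univ f x) = 0 := by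
  have hy : extChartAt (𝓡 n) x x ∈ (extChartAt (𝓡 n) x).target := mem_extChartAt_target x
  have hxx := (extChartAt (𝓡 n) x).left_inv (mem_extChartAt_source x)
  have h1 : ContDiffAt ℝ 2 (fun y => f ((extChartAt (𝓡 n) x).symm y)) (extChartAt (𝓡 n) x x) :=
    contDiffAt_comp_symm two_le_infty hy (by rwa [hxx])
  set X := coords n x (gradWithin n univ f x) with hX
  have hXX : metricAt n x X X = 1 := by
    rw [hX, metricAt_coords, real_inner_self_eq_norm_sq, hg.self_of_nhds, one_pow]
  have hev : ∀ᶠ y in 𝓝 (extChartAt (𝓡 n) x x), y ∈ (extChartAt (𝓡 n) x).target ∧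
      ContMDiffAt (𝓡 n) 𝓘(ℝ, ℝ) 2 f ((extChartAt (𝓡 n) x).symm y) ∧
      ‖gradWithin n univ f ((extChartAt (𝓡 n) x).symm y)‖ = 1 := by
    have hc : Tendsto (extChartAt (𝓡 n) x).symm (𝓝 (extChartAt (𝓡 n) x x)) (𝓝 x) := by
      have := continuousAt_extChartAt_symm (I := 𝓡 n) x
      rwa [ContinuousAt, hxx] at this
    exact ((isOpen_extChartAt_target x).eventually_mem hy).and
      (hc.eventually (((contMDiffAt_iff_contMDiffAt_nhds (by simp)).1 hf).and hg))
  have key := hessian_gradient_eq_zero (G := chartG n x)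
    (F := fun y => f ((extChartAt (𝓡 n) x).symm y)) (y := extChartAt (𝓡 n) x x) (X := X)
    (differentiableAt_chartG hy)
    ((h1.fderiv_right (m := 1) (by norm_num)).differentiableAt (by simp))
    -- Cauchy–Schwarz with |∇f| = 1 at nearby points; X is the gradient at x, kept constant in the
    -- chart.
    (by
      filter_upwards [hev] with y hy
      rw [fderiv_comp_symm hy.1 (hy.2.1.mdifferentiableAt (by simp)), chartG_apply, metricAt_self]
      have h2 := abs_metricAt_le (n := n) ((extChartAt (𝓡 n) x).symm y)
        (coords n _ (gradWithin n univ f ((extChartAt (𝓡 n) x).symm y))) (frame n x y X)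
      rw [ContinuousLinearEquiv.symm_apply_apply, hy.2.2, one_mul] at h2
      exact sq_le_sq' (abs_le.1 h2).1 (abs_le.1 h2).2)
    (by
      have h3 : MDifferentiableAt (𝓡 n) 𝓘(ℝ, ℝ) f x := hf.mdifferentiableAt (by simp)
      rw [fderiv_comp_symm hy (by rwa [hxx]), frame_self, hxx]
      exact hXX)
    (by rw [chartG_self, hXX]) (coords n x u)
  rw [hessWithin_univ_eq, ← hX, key, christoffel_eq, sub_self]

end Gradient

/-! ### The distance function to a geodesic sphere -/

section SphereDist

variable {n : ℕ} {M : Type*} [MetricSpace M] [ChartedSpace (EuclideanSpace ℝ (Fin n)) M]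
  [RiemannianBundle (fun x : M => TangentSpace (𝓡 n) x)] [IsManifold (𝓡 n) ∞ M]
  [IsContMDiffRiemannianBundle (𝓡 n) ∞ (EuclideanSpace ℝ (Fin n))
      (fun x : M => TangentSpace (𝓡 n) x)] [IsRiemannianManifold (𝓡 n) M]
  {p x : M} {ρ : ℝ} {e : OpenPartialHomeomorph (TangentSpace (𝓡 n) p) M}

namespace IsExpDiffeo

theorem sphereDist_eq (he : IsExpDiffeo n p ρ e) (r : ℝ) (hx : x ∈ Metric.ball p ρ) :
    sphereDist p r x = ‖e.symm x‖ - r := by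
  have h1 : x ∈ e.target := by rwa [he.target_eq]
  have h2 := e.map_target h1
  rw [he.source_eq] at h2
  rw [sphereDist, ← he.dist_eq h2, e.right_inv h1]

theorem contMDiffAt_sphereDist (he : IsExpDiffeo n p ρ e) (r : ℝ) (hx : x ∈ Metric.ball p ρ)
    (hne : x ≠ p) : ContMDiffAt (𝓡 n) 𝓘(ℝ, ℝ) ∞ (sphereDist p r) x := by
  have h1 : x ∈ e.target := by rwa [he.target_eq]
  have h0 : e.symm x ≠ 0 := fun h => hne (by rw [← e.right_inv h1, h, he.map_zero])
  have h2 : ContMDiffAt (𝓡 n) 𝓘(ℝ, TangentSpace (𝓡 n) p) ∞ e.symm x :=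
    he.smooth_symm.contMDiffAt (e.open_target.mem_nhds h1)
  have h3 : ContDiffAt ℝ ∞ (fun v : TangentSpace (𝓡 n) p => ‖v‖ - r) (e.symm x) :=
    (contDiffAt_norm ℝ h0).sub contDiffAt_const
  refine (h3.contMDiffAt.comp x h2).congr_of_eventuallyEq ?_
  filter_upwards [Metric.isOpen_ball.mem_nhds hx] with y hy
  exact he.sphereDist_eq r hy

theorem mder_surjective (he : IsExpDiffeo n p ρ e) {v : TangentSpace (𝓡 n) p}
    (hv : v ∈ Metric.ball 0 ρ) (u : Model n) : ∃ w, mder n e v w = u := by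
  rw [← he.source_eq] at hv
  obtain ⟨x, hx, rfl⟩ : ∃ x, x ∈ e.target ∧ e.symm x = v :=
    ⟨e v, e.map_source hv, e.left_inv hv⟩
  have h2 : MDifferentiableAt (𝓡 n) 𝓘(ℝ, TangentSpace (𝓡 n) p) e.symm x :=
    (he.smooth_symm.contMDiffAt (e.open_target.mem_nhds hx)).mdifferentiableAt (by simp)
  have h3 : MDifferentiableAt 𝓘(ℝ, TangentSpace (𝓡 n) p) (𝓡 n) e (e.symm x) :=
    he.mdifferentiableAt (by rwa [← he.source_eq])
  have h4 := mfderiv_comp x h3 h2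
  have h5 : (e ∘ e.symm) =ᶠ[𝓝 x] id := by
    filter_upwards [e.open_target.mem_nhds hx] with y hy
    exact e.right_inv hy
  rw [h5.mfderiv_eq, mfderiv_id] at h4
  have h6 := DFunLike.congr_fun h4 ((coords n x).symm u)
  exact ⟨mfderiv (𝓡 n) 𝓘(ℝ, TangentSpace (𝓡 n) p) e.symm x ((coords n x).symm u), h6.symm⟩

/-- In exponential coordinates d is the norm minus r, with differential ⟨v, ·⟩/|v|. By the Gauss
lemma its gradient is the image of v divided by |v|, and the image of v has length |v|. -/
theorem norm_grad_sphereDist (he : IsExpDiffeo n p ρ e) (r : ℝ) (hx : x ∈ Metric.ball p ρ)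
    (hne : x ≠ p) : ‖gradWithin n univ (sphereDist p r) x‖ = 1 := by
  have h1 : x ∈ e.target := by rwa [he.target_eq]
  obtain ⟨v, hv, rfl⟩ : ∃ v, v ∈ Metric.ball 0 ρ ∧ e v = x :=
    ⟨e.symm x, by rw [← he.source_eq]; exact e.map_target h1, e.right_inv h1⟩
  have h0 : v ≠ 0 := fun h => hne (by rw [h, he.map_zero])
  have hpos : 0 < ‖v‖ := norm_pos_iff.2 h0
  have hd := (he.contMDiffAt_sphereDist r hx hne).mdifferentiableAt (by simp)
  have key : ∀ w, ⟪gradWithin n univ (sphereDist p r) (e v),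
      (coords n (e v)).symm (mder n e v w)⟫ = ⟪v, w⟫ / ‖v‖ := by
    intro w
    rw [inner_grad, ← fderiv_comp_eq_mder n hd (he.mdifferentiableAt hv)]
    have h2 : (fun u => sphereDist p r (e u)) =ᶠ[𝓝 v] fun u => √(‖u‖ ^ 2) - r := by
      filter_upwards [Metric.isOpen_ball.mem_nhds hv] with u hu
      rw [sphereDist, he.dist_eq hu, Real.sqrt_sq (norm_nonneg _)]
    have h3 : HasFDerivAt (fun u : TangentSpace (𝓡 n) p => √(‖u‖ ^ 2) - r)
        ((1 / (2 * √(‖v‖ ^ 2))) • (2 • innerSL ℝ v)) v :=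
      ((hasStrictFDerivAt_norm_sq v).hasFDerivAt.sqrt (by positivity)).sub_const r
    rw [h2.fderiv_eq, h3.fderiv, Real.sqrt_sq (norm_nonneg _)]
    simp
    field_simp
  have hsp := he.norm_speed hv (t := 1) (by simp)
  rw [one_smul] at hsp
  set g := gradWithin n univ (sphereDist p r) (e v) with hg
  refine le_antisymm ?_ ?_
  -- Upper bound: represent the gradient itself as an image vector and apply Cauchy–Schwarz against
  -- the image of v.
  · obtain ⟨w, hw⟩ := he.mder_surjective hv (coords n (e v) g)
    have h4 := key w
    rw [hw, ContinuousLinearEquiv.symm_apply_apply, real_inner_self_eq_norm_sq, ← he.gauss hv,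
      hw] at h4
    have h5 := (le_abs_self _).trans
      (abs_metricAt_le (n := n) (e v) (mder n e v v) (coords n (e v) g))
    rw [ContinuousLinearEquiv.symm_apply_apply, hsp] at h5
    rw [eq_div_iff hpos.ne'] at h4
    by_contra hlt
    push Not at hlt
    nlinarith [mul_pos hpos (lt_trans one_pos hlt)]
  -- Lower bound: test the gradient against the image of v.
  · have h4 := key v
    rw [real_inner_self_eq_norm_sq, sq, mul_div_assoc, div_self hpos.ne', mul_one] at h4
    have h5 := real_inner_le_norm g ((coords n (e v)).symm (mder n e v v))
    rw [h4, hsp] at h5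
    exact le_of_mul_le_mul_right (by linarith) hpos

end IsExpDiffeo

theorem exists_isExpDiffeo (hx : edist x p < injRadius n p) :
    ∃ (ρ : ℝ) (e : OpenPartialHomeomorph (TangentSpace (𝓡 n) p) M),
      IsExpDiffeo n p ρ e ∧ x ∈ Metric.ball p ρ := by
  simp only [injRadius, lt_iSup_iff] at hx
  obtain ⟨ρ, hρ, ⟨e, he⟩, h⟩ := hx
  refine ⟨ρ, e, he, ?_⟩
  rw [edist_dist, ENNReal.ofReal_lt_ofReal_iff hρ] at h
  exact h

variable (n) in
theorem contMDiffAt_sphereDist (r : ℝ) (hx : edist x p < injRadius n p) (hne : x ≠ p) :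
    ContMDiffAt (𝓡 n) 𝓘(ℝ, ℝ) 2 (sphereDist p r) x := by
  obtain ⟨ρ, e, he, h⟩ := exists_isExpDiffeo hx
  exact ContMDiffAt.of_le (he.contMDiffAt_sphereDist r h hne) two_le_infty

theorem norm_grad_sphereDist (r : ℝ) (hx : edist x p < injRadius n p) (hne : x ≠ p) :
    ‖gradWithin n univ (sphereDist p r) x‖ = 1 := by
  obtain ⟨ρ, e, he, h⟩ := exists_isExpDiffeo hx
  exact he.norm_grad_sphereDist r h hne

variable (n) in
theorem eventually_edist_lt_injRadius (hx : edist x p < injRadius n p) (hne : x ≠ p) :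
    ∀ᶠ y in 𝓝 x, edist y p < injRadius n p ∧ y ≠ p :=
  ((continuous_id.edist continuous_const).continuousAt.eventually (gt_mem_nhds hx)).and
    (isOpen_ne.eventually_mem hne)

/-- The unit-gradient identity holds on a whole neighbourhood of x, so it may be differentiated. -/
theorem hess_sphereDist_grad (r : ℝ) (hx : edist x p < injRadius n p) (hne : x ≠ p)
    (u : TangentSpace (𝓡 n) x) :
    hessWithin n univ (sphereDist p r) x u (gradWithin n univ (sphereDist p r) x) = 0 :=
  hess_grad_eq_zero (contMDiffAt_sphereDist n r hx hne)
    ((eventually_edist_lt_injRadius n hx hne).mono fun _ hy => norm_grad_sphereDist r hy.1 hy.2) u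

theorem hess_grad_sphereDist (r : ℝ) (hx : edist x p < injRadius n p) (hne : x ≠ p)
    (u : TangentSpace (𝓡 n) x) :
    hessWithin n univ (sphereDist p r) x (gradWithin n univ (sphereDist p r) x) u = 0 := by
  rw [hess_symm (contMDiffAt_sphereDist n r hx hne), hess_sphereDist_grad r hx hne]

end SphereDist
end MinGraph

end

noncomputable section

namespace MinGraph

set_option synthInstance.maxHeartbeats 400000
set_option maxHeartbeats 1000000

/-! ### Traces in arbitrary bases; linearity of Christoffel symbols -/

section LinearAlgebra

/-- The trace of a bilinear form with respect to an inner product, in an arbitrary basis. -/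
theorem sum_orthonormalBasis_eq_trace {E ι κ : Type*} [NormedAddCommGroup E]
    [InnerProductSpace ℝ E] [Fintype ι] [Fintype κ] [DecidableEq ι] [DecidableEq κ]
    (e : OrthonormalBasis ι ℝ E) (b : Module.Basis κ ℝ E) (B : E →ₗ[ℝ] E →ₗ[ℝ] ℝ) :
    ∑ i, B (e i) (e i) = Matrix.trace
      ((Matrix.of fun k l => ⟪b k, b l⟫)⁻¹ * Matrix.of fun k l => B (b k) (b l)) := by
  set P := b.toMatrix e.toBasis with hP
  have hg : Matrix.of (fun k l => ⟪b k, b l⟫) = LinearMap.toMatrix₂ b b (innerₗ E) := by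
    ext k l; simp [LinearMap.toMatrix₂_apply]
  have hh : Matrix.of (fun k l => B (b k) (b l)) = LinearMap.toMatrix₂ b b B := by
    ext k l; simp [LinearMap.toMatrix₂_apply]
  have h1 : P.transpose * LinearMap.toMatrix₂ b b (innerₗ E) * P = 1 := by
    rw [hP, LinearMap.toMatrix₂_mul_basis_toMatrix]
    ext i j
    simp [LinearMap.toMatrix₂_apply, Matrix.one_apply, orthonormal_iff_ite.1 e.orthonormal]
  have hcard : Fintype.card ι = Fintype.card κ := by
    rw [← Module.finrank_eq_card_basis e.toBasis, Module.finrank_eq_card_basis b]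
  -- From PᵀgP = 1, with index sets of equal size, (PPᵀ)g = 1; thus PPᵀ is the inverse Gram matrix,
  -- and cyclicity of the trace concludes.
  have h2 := (Matrix.mul_eq_one_comm_of_card_eq ι κ ℝ hcard).1 h1
  rw [← Matrix.mul_assoc] at h2
  rw [hg, hh, Matrix.inv_eq_left_inv h2, Matrix.mul_assoc, Matrix.trace_mul_comm,
    hP, LinearMap.toMatrix₂_mul_basis_toMatrix]
  simp [Matrix.trace, LinearMap.toMatrix₂_apply]

theorem continuousAt_matrix_of {X ι κ R : Type*} [TopologicalSpace X] [TopologicalSpace R]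
    {x : X} {f : X → ι → κ → R} (h : ∀ i k, ContinuousAt (fun x => f x i k) x) :
    ContinuousAt (fun x => Matrix.of (f x)) x :=
  continuousAt_pi.2 fun i => continuousAt_pi.2 fun k => h i k

theorem isInvertible_of_pos {V : Type*} [NormedAddCommGroup V] [NormedSpace ℝ V]
    [FiniteDimensional ℝ V] (B : V →L[ℝ] V →L[ℝ] ℝ) (h : ∀ v, B v v = 0 → v = 0) :
    B.IsInvertible := by
  have hinj : Function.Injective (B : V →ₗ[ℝ] V →L[ℝ] ℝ) := by
    refine (injective_iff_map_eq_zero _).2 fun v hv => h v ?_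
    have : B v = 0 := hv
    simp [this]
  have hrank : Module.finrank ℝ V = Module.finrank ℝ (V →L[ℝ] ℝ) := by
    rw [← LinearEquiv.finrank_eq (LinearMap.toContinuousLinearMap (𝕜 := ℝ) (E := V) (F' := ℝ))]
    exact Subspace.dual_finrank_eq.symm
  refine ⟨(LinearEquiv.ofInjectiveOfFinrankEq _ hinj hrank).toContinuousLinearEquiv, ?_⟩
  ext1 v
  exact DFunLike.congr_fun (LinearEquiv.coe_ofInjectiveOfFinrankEq _ hinj hrank) v

variable {E : Type*} [NormedAddCommGroup E] [NormedSpace ℝ E] (G : E → E →L[ℝ] E →L[ℝ] ℝ)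
  (y u u' v w : E) (a : ℝ)

theorem christoffelForm_add_left : christoffelForm G y (u + u') v w
    = christoffelForm G y u v w + christoffelForm G y u' v w := by
  have h1 : fderiv ℝ G y (u + u') v w = fderiv ℝ G y u v w + fderiv ℝ G y u' v w := by
    rw [(fderiv ℝ G y).map_add]; rfl
  have h2 : fderiv ℝ G y v (u + u') w = fderiv ℝ G y v u w + fderiv ℝ G y v u' w := by
    rw [(fderiv ℝ G y v).map_add]; rfl
  have h3 := (fderiv ℝ G y w).map_add u u'
  have h4 : fderiv ℝ G y w (u + u') v = fderiv ℝ G y w u v + fderiv ℝ G y w u' v := by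
    rw [h3]; rfl
  simp only [christoffelForm, h1, h2, h4]
  ring

theorem christoffelForm_add_right : christoffelForm G y v (u + u') w
    = christoffelForm G y v u w + christoffelForm G y v u' w := by
  have h1 : fderiv ℝ G y (u + u') v w = fderiv ℝ G y u v w + fderiv ℝ G y u' v w := by
    rw [(fderiv ℝ G y).map_add]; rfl
  have h2 : fderiv ℝ G y v (u + u') w = fderiv ℝ G y v u w + fderiv ℝ G y v u' w := by
    rw [(fderiv ℝ G y v).map_add]; rfl
  have h4 := (fderiv ℝ G y w v).map_add u u'
  simp only [christoffelForm, h1, h2, h4]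
  ring

theorem christoffelForm_add_third : christoffelForm G y v w (u + u')
    = christoffelForm G y v w u + christoffelForm G y v w u' := by
  have h1 : fderiv ℝ G y (u + u') v w = fderiv ℝ G y u v w + fderiv ℝ G y u' v w := by
    rw [(fderiv ℝ G y).map_add]; rfl
  simp only [christoffelForm, h1, (fderiv ℝ G y v w).map_add, (fderiv ℝ G y w v).map_add]
  ring

theorem christoffelForm_smul_left : christoffelForm G y (a • u) v w
    = a * christoffelForm G y u v w := by
  have h1 : fderiv ℝ G y (a • u) v w = a * fderiv ℝ G y u v w := by
    rw [(fderiv ℝ G y).map_smul]; rfl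
  have h2 : fderiv ℝ G y v (a • u) w = a * fderiv ℝ G y v u w := by
    rw [(fderiv ℝ G y v).map_smul]; rfl
  have h3 : fderiv ℝ G y w (a • u) v = a * fderiv ℝ G y w u v := by
    rw [(fderiv ℝ G y w).map_smul]; rfl
  simp only [christoffelForm, h1, h2, h3]
  ring

theorem christoffelForm_smul_right : christoffelForm G y v (a • u) w
    = a * christoffelForm G y v u w := by
  have h1 : fderiv ℝ G y (a • u) v w = a * fderiv ℝ G y u v w := by
    rw [(fderiv ℝ G y).map_smul]; rfl
  have h2 : fderiv ℝ G y v (a • u) w = a * fderiv ℝ G y v u w := by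
    rw [(fderiv ℝ G y v).map_smul]; rfl
  simp only [christoffelForm, h1, h2, (fderiv ℝ G y w v).map_smul, smul_eq_mul]
  ring

theorem christoffelForm_smul_third : christoffelForm G y v w (a • u)
    = a * christoffelForm G y v w u := by
  have h1 : fderiv ℝ G y (a • u) v w = a * fderiv ℝ G y u v w := by
    rw [(fderiv ℝ G y).map_smul]; rfl
  simp only [christoffelForm, h1, (fderiv ℝ G y v w).map_smul, (fderiv ℝ G y w v).map_smul,
    smul_eq_mul]
  ring

theorem continuousAt_christoffelForm
    {G : E → E →L[ℝ] E →L[ℝ] ℝ} {y : E} (hG : ContDiffAt ℝ 2 G y) {X : E → E}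
    (hX : ContinuousAt X y) (u v : E) :
    ContinuousAt (fun z => christoffelForm G z u v (X z)) y := by
  have h3 := (hG.fderiv_right (m := 1) (by norm_num)).continuousAt
  have cu : ContinuousAt (fun _ : E => u) y := continuousAt_const
  have cv : ContinuousAt (fun _ : E => v) y := continuousAt_const
  unfold christoffelForm
  exact (((((h3.clm_apply cu).clm_apply cv).clm_apply hX).add
    (((h3.clm_apply cv).clm_apply cu).clm_apply hX)).sub
    (((h3.clm_apply hX).clm_apply cu).clm_apply cv)).div_const 2

end LinearAlgebra

/-! ### Hessian and Laplacian in a fixed chart; continuity -/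

section HessForm

variable {n : ℕ} {M : Type*} [MetricSpace M] [ChartedSpace (EuclideanSpace ℝ (Fin n)) M]
  [RiemannianBundle (fun x : M => TangentSpace (𝓡 n) x)] [IsManifold (𝓡 n) ∞ M]
  [IsContMDiffRiemannianBundle (𝓡 n) ∞ (EuclideanSpace ℝ (Fin n))
      (fun x : M => TangentSpace (𝓡 n) x)]

/-- The Hessian as a bilinear form. -/
def hessForm (s : Set M) (f : M → ℝ) (x : M) :
    TangentSpace (𝓡 n) x →ₗ[ℝ] TangentSpace (𝓡 n) x →ₗ[ℝ] ℝ :=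
  LinearMap.mk₂ ℝ (hessWithin n s f x)
    (by
      intro u u' v
      simp only [hessWithin, christoffel_eq, map_add, add_apply, christoffelForm_add_left]
      ring)
    (by
      intro a u v
      simp only [hessWithin, christoffel_eq, map_smul, smul_apply, christoffelForm_smul_left,
        smul_eq_mul]
      ring)
    (by
      intro u u' v
      simp only [hessWithin, christoffel_eq, map_add, christoffelForm_add_right]
      ring)
    (by
      intro a u v
      simp only [hessWithin, christoffel_eq, map_smul, christoffelForm_smul_right, smul_eq_mul]
      ring)

theorem hessForm_apply (s : Set M) (f : M → ℝ) (x : M) (u v : TangentSpace (𝓡 n) x) :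
    hessForm s f x u v = hessWithin n s f x u v := rfl

/-- The Hessian in the preferred chart around `x`, at the point with coordinates `y`. -/
theorem hess_frame {f : M → ℝ} {x : M} {y X : Model n} (hy : y ∈ (extChartAt (𝓡 n) x).target)
    (hf : ContMDiffAt (𝓡 n) 𝓘(ℝ, ℝ) 2 f ((extChartAt (𝓡 n) x).symm y))
    (hX : frame n x y X = coords n _ (gradWithin n univ f ((extChartAt (𝓡 n) x).symm y)))
    (u v : Model n) :
    hessWithin n univ f ((extChartAt (𝓡 n) x).symm y)
        ((coords n _).symm (frame n x y u)) ((coords n _).symm (frame n x y v))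
      = fderiv ℝ (fderiv ℝ (fun y => f ((extChartAt (𝓡 n) x).symm y))) y u v
        - christoffelForm (chartG n x) y u v X := by
  set z := (extChartAt (𝓡 n) x).symm y with hz
  have hzt : extChartAt (𝓡 n) z z ∈ (extChartAt (𝓡 n) z).target := mem_extChartAt_target z
  have hzz := (extChartAt (𝓡 n) z).left_inv (mem_extChartAt_source z)
  have hev : ∀ᶠ w in 𝓝 y, w ∈ (extChartAt (𝓡 n) x).target ∧
      (extChartAt (𝓡 n) x).symm w ∈ (extChartAt (𝓡 n) z).source := by
    refine ((isOpen_extChartAt_target x).eventually_mem hy).and ?_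
    exact ((mdifferentiableAt_extChartAt_symm n hy).continuousAt).eventually
      ((isOpen_extChartAt_source z).eventually_mem (mem_extChartAt_source z))
  have hfr : ∀ w, w ∈ (extChartAt (𝓡 n) x).target ∧
      (extChartAt (𝓡 n) x).symm w ∈ (extChartAt (𝓡 n) z).source →
      ∀ a b, chartG n x w a b = chartG n z (extChartAt (𝓡 n) z ((extChartAt (𝓡 n) x).symm w))
        (fderiv ℝ (fun w => extChartAt (𝓡 n) z ((extChartAt (𝓡 n) x).symm w)) w a)
        (fderiv ℝ (fun w => extChartAt (𝓡 n) z ((extChartAt (𝓡 n) x).symm w)) w b) := by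
    intro w hw a b
    exact metricAt_mder n (mdifferentiableAt_extChartAt_symm n hw.1) hw.2 a b
  -- The frame of the chart at z is the identity at z, so the frame of the chart at x is the
  -- differential of the transition map.
  have hD : frame n x y =
      fderiv ℝ (fun w => extChartAt (𝓡 n) z ((extChartAt (𝓡 n) x).symm w)) y := by
    have h := mder_eq_frame_comp n (mdifferentiableAt_extChartAt_symm n hy)
      (mem_extChartAt_source (I := 𝓡 n) z)
    rw [← hz, frame_self, ContinuousLinearMap.id_comp] at h
    exact h
  have hT : ContDiffAt ℝ 2 (fun w => extChartAt (𝓡 n) z ((extChartAt (𝓡 n) x).symm w)) y := by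
    have h1 : ContMDiffAt 𝓘(ℝ, Model n) (𝓡 n) ∞ (extChartAt (𝓡 n) x).symm y :=
      (contMDiffOn_extChartAt_symm (I := 𝓡 n) (n := ∞) x).contMDiffAt
        ((isOpen_extChartAt_target x).mem_nhds hy)
    have h2 : ContMDiffAt (𝓡 n) 𝓘(ℝ, Model n) ∞ (extChartAt (𝓡 n) z)
        ((extChartAt (𝓡 n) x).symm y) := contMDiffAt_extChartAt
    exact ContDiffAt.of_le (h2.comp y h1).contDiffAt two_le_infty
  have hF : ContDiffAt ℝ 2 (fun w => f ((extChartAt (𝓡 n) z).symm w)) (extChartAt (𝓡 n) z z) :=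
    contDiffAt_comp_symm two_le_infty hzt (by rwa [hzz])
  have key := hessian_transform hT (G := chartG n z) (G' := chartG n x)
    (differentiableAt_chartG hzt) (differentiableAt_chartG hy) (chartG_symm n z)
    (by filter_upwards [hev] with w hw using hfr w hw) hF
    (F' := fun y => f ((extChartAt (𝓡 n) x).symm y))
    (by
      filter_upwards [hev] with w hw
      rw [(extChartAt (𝓡 n) z).left_inv hw.2])
    (X := X)
    (by
      intro a
      rw [← hD, hX, fderiv_comp_symm hzt (by rw [hzz]; exact hf.mdifferentiableAt (by simp)),
        chartG_self, hzz, frame_self, metricAt_symm]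
      rfl)
    u v
  rw [key, hessWithin_univ_eq, christoffel_eq, ← hD, hX]
  rfl

theorem chartG_isInvertible {x : M} {y : Model n} (hy : y ∈ (extChartAt (𝓡 n) x).target) :
    (chartG n x y).IsInvertible := by
  refine isInvertible_of_pos _ fun v hv => ?_
  rw [chartG_apply, metricAt_self] at hv
  have h1 := norm_eq_zero.1 (eq_zero_of_pow_eq_zero hv)
  have h2 : frame n x y v = 0 := (ContinuousLinearEquiv.map_eq_zero_iff _).1 h1
  obtain ⟨T, hT⟩ := frame_isInvertible n hy
  rw [← hT] at h2
  simpa using h2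

/-- The coordinates of the gradient of `f`, in the preferred chart around `x`. -/
def chartGrad (f : M → ℝ) (x : M) (y : Model n) : Model n :=
  (chartG n x y).inverse (fderiv ℝ (fun y => f ((extChartAt (𝓡 n) x).symm y)) y)

theorem frame_chartGrad {f : M → ℝ} {x : M} {y : Model n}
    (hy : y ∈ (extChartAt (𝓡 n) x).target)
    (hf : MDifferentiableAt (𝓡 n) 𝓘(ℝ, ℝ) f ((extChartAt (𝓡 n) x).symm y)) :
    frame n x y (chartGrad f x y)
      = coords n _ (gradWithin n univ f ((extChartAt (𝓡 n) x).symm y)) := by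
  obtain ⟨T, hT⟩ := frame_isInvertible n hy
  set g := coords n _ (gradWithin n univ f ((extChartAt (𝓡 n) x).symm y)) with hg
  have h1 : frame n x y (T.symm g) = g := by rw [← hT]; simp
  have h2 : chartG n x y (T.symm g) = fderiv ℝ (fun y => f ((extChartAt (𝓡 n) x).symm y)) y := by
    ext v
    rw [fderiv_comp_symm hy hf, chartG_apply, h1]
  obtain ⟨S, hS⟩ := chartG_isInvertible hy
  rw [chartGrad, ← h2, ← hS, ContinuousLinearMap.inverse_equiv]
  simp [h1]

/-- The Hessian of `f` in the preferred chart around `x`. -/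
def chartHess (f : M → ℝ) (x : M) (y u v : Model n) : ℝ :=
  fderiv ℝ (fderiv ℝ (fun y => f ((extChartAt (𝓡 n) x).symm y))) y u v
    - christoffelForm (chartG n x) y u v (chartGrad f x y)

/-- `hessWithin` uses a different chart at every point; the right-hand side refers to the chart at x
alone, so its continuity in y can be read off. -/
theorem hess_eq_chartHess {f : M → ℝ} {x : M} {y : Model n}
    (hy : y ∈ (extChartAt (𝓡 n) x).target)
    (hf : ContMDiffAt (𝓡 n) 𝓘(ℝ, ℝ) 2 f ((extChartAt (𝓡 n) x).symm y)) (u v : Model n) :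
    hessWithin n univ f ((extChartAt (𝓡 n) x).symm y)
        ((coords n _).symm (frame n x y u)) ((coords n _).symm (frame n x y v))
      = chartHess f x y u v :=
  hess_frame hy hf (frame_chartGrad hy (hf.mdifferentiableAt (by simp))) u v

theorem continuousAt_chartG {x : M} {y : Model n} (hy : y ∈ (extChartAt (𝓡 n) x).target)
    (u v : Model n) : ContinuousAt (fun y => chartG n x y u v) y :=
  ((contDiffAt_chartG hy).continuousAt.clm_apply continuousAt_const).clm_apply continuousAt_const

theorem continuousAt_chartGrad {f : M → ℝ} {x : M} {y : Model n}
    (hy : y ∈ (extChartAt (𝓡 n) x).target)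
    (hf : ContMDiffAt (𝓡 n) 𝓘(ℝ, ℝ) 2 f ((extChartAt (𝓡 n) x).symm y)) :
    ContinuousAt (chartGrad f x) y := by
  obtain ⟨S, hS⟩ := chartG_isInvertible hy
  have h1 : ContinuousAt (fun y => (chartG n x y).inverse) y := by
    have h2 := (contDiffAt_map_inverse (n := 0) (𝕜 := ℝ) S).continuousAt
    rw [hS] at h2
    exact ContinuousAt.comp (g := ContinuousLinearMap.inverse) h2
      (contDiffAt_chartG hy).continuousAt
  have h3 := (contDiffAt_comp_symm two_le_infty hy hf).fderiv_right (m := 1) (by norm_num)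
  exact h1.clm_apply h3.continuousAt

theorem continuousAt_chartHess {f : M → ℝ} {x : M} {y : Model n}
    (hy : y ∈ (extChartAt (𝓡 n) x).target)
    (hf : ContMDiffAt (𝓡 n) 𝓘(ℝ, ℝ) 2 f ((extChartAt (𝓡 n) x).symm y)) (u v : Model n) :
    ContinuousAt (fun y => chartHess f x y u v) y := by
  have h1 := ((contDiffAt_comp_symm two_le_infty hy hf).fderiv_right (m := 1) (by norm_num))
  have h2 : ContinuousAt (fderiv ℝ (fderiv ℝ (fun y => f ((extChartAt (𝓡 n) x).symm y)))) y :=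
    (h1.fderiv_right (m := 0) (by norm_num)).continuousAt
  exact ((h2.clm_apply continuousAt_const).clm_apply continuousAt_const).sub
    (continuousAt_christoffelForm (ContDiffAt.of_le (contDiffAt_chartG hy) two_le_infty)
      (continuousAt_chartGrad hy hf) u v)

/-- The orthonormal bases defining the Laplacian are chosen point by point, with no continuity; the
Gram matrix of coordinate fields replaces them by continuous data. -/
theorem laplacian_eq_trace (b : OrthonormalBasis (Fin n) ℝ (Model n)) {f : M → ℝ} {x : M}
    {y : Model n} (hy : y ∈ (extChartAt (𝓡 n) x).target)
    (hf : ContMDiffAt (𝓡 n) 𝓘(ℝ, ℝ) 2 f ((extChartAt (𝓡 n) x).symm y)) :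
    laplacianWithin n univ f ((extChartAt (𝓡 n) x).symm y) = Matrix.trace
      ((Matrix.of fun k l => chartG n x y (b k) (b l))⁻¹
        * Matrix.of fun k l => chartHess f x y (b k) (b l)) := by
  obtain ⟨T, hT⟩ := frame_isInvertible n hy
  let b' : Module.Basis (Fin n) ℝ (TangentSpace (𝓡 n) ((extChartAt (𝓡 n) x).symm y)) :=
    b.toBasis.map (T.trans (coords n _).symm).toLinearEquiv
  have hb : ∀ k, b' k = (coords n _).symm (frame n x y (b k)) := by
    intro k
    rw [← hT]
    simp only [b', Module.Basis.map_apply, OrthonormalBasis.coe_toBasis]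
    rfl
  have key := sum_orthonormalBasis_eq_trace
    (stdOrthonormalBasis ℝ (TangentSpace (𝓡 n) ((extChartAt (𝓡 n) x).symm y))) b'
    (hessForm univ f _)
  simp only [hessForm_apply, hb, hess_eq_chartHess hy hf] at key
  exact key

theorem continuousAt_laplacian {f : M → ℝ} {x : M} (hf : ContMDiffAt (𝓡 n) 𝓘(ℝ, ℝ) 2 f x) :
    ContinuousAt (laplacianWithin n univ f) x := by
  have hy : extChartAt (𝓡 n) x x ∈ (extChartAt (𝓡 n) x).target := mem_extChartAt_target x
  have hxx := (extChartAt (𝓡 n) x).left_inv (mem_extChartAt_source x)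
  have hf' : ContMDiffAt (𝓡 n) 𝓘(ℝ, ℝ) 2 f
    ((extChartAt (𝓡 n) x).symm (extChartAt (𝓡 n) x x)) := by rwa [hxx]
  obtain ⟨b⟩ : Nonempty (OrthonormalBasis (Fin n) ℝ (Model n)) := ⟨EuclideanSpace.basisFun _ ℝ⟩
  have h1 : ContinuousAt (fun y => Matrix.of fun k l => chartG n x y (b k) (b l))
      (extChartAt (𝓡 n) x x) :=
    continuousAt_matrix_of fun k l => continuousAt_chartG hy (b k) (b l)
  have h2 : ContinuousAt (fun y => Matrix.of fun k l => chartHess f x y (b k) (b l))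
      (extChartAt (𝓡 n) x x) :=
    continuousAt_matrix_of fun k l => continuousAt_chartHess hy hf' (b k) (b l)
  -- Nonvanishing determinant, as the Gram matrix of a basis; hence matrix inversion is continuous
  -- there.
  have h3 : (Matrix.of fun k l => chartG n x (extChartAt (𝓡 n) x x) (b k) (b l)).det ≠ 0 := by
    have h4 := (Matrix.det_gram_ne_zero_iff_linearIndependent (𝕜 := ℝ)
      (v := fun k => (coords n x).symm (b k))).2
      (b.toBasis.map (coords n x).symm.toLinearEquiv).linearIndependent
    have h5 : (Matrix.of fun k l => chartG n x (extChartAt (𝓡 n) x x) (b k) (b l))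
        = Matrix.gram ℝ fun k => (coords n x).symm (b k) := by
      ext k l
      exact chartG_self x (b k) (b l)
    rwa [h5]
  have h5 : ContinuousAt (fun y => (Matrix.of fun k l => chartG n x y (b k) (b l))⁻¹)
      (extChartAt (𝓡 n) x x) :=
    ContinuousAt.comp (g := Inv.inv)
      (f := fun y => Matrix.of fun k l => chartG n x y (b k) (b l))
      (continuousAt_matrix_inv _ (by simpa [Ring.inverse_eq_inv'] using continuousAt_inv₀ h3)) h1
  have h6 : ContinuousAt (fun y => Matrix.trace
      ((Matrix.of fun k l => chartG n x y (b k) (b l))⁻¹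
        * Matrix.of fun k l => chartHess f x y (b k) (b l))) (extChartAt (𝓡 n) x x) :=
    ContinuousAt.comp (g := Matrix.trace) (continuous_id.matrix_trace).continuousAt (h5.mul h2)
  have h7 : ContinuousAt (fun z => Matrix.trace
      ((Matrix.of fun k l => chartG n x (extChartAt (𝓡 n) x z) (b k) (b l))⁻¹
        * Matrix.of fun k l => chartHess f x (extChartAt (𝓡 n) x z) (b k) (b l))) x :=
    ContinuousAt.comp (f := extChartAt (𝓡 n) x) (g := fun y => Matrix.trace
      ((Matrix.of fun k l => chartG n x y (b k) (b l))⁻¹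
        * Matrix.of fun k l => chartHess f x y (b k) (b l))) h6 (continuousAt_extChartAt x)
  have h8 : ∀ᶠ z in 𝓝 x, z ∈ (extChartAt (𝓡 n) x).source ∧ ContMDiffAt (𝓡 n) 𝓘(ℝ, ℝ) 2 f z :=
    ((isOpen_extChartAt_source x).eventually_mem (mem_extChartAt_source x)).and
      ((contMDiffAt_iff_contMDiffAt_nhds (by simp)).1 hf)
  refine h7.congr (h8.mono fun z hz => ?_)
  have h9 := (extChartAt (𝓡 n) x).left_inv hz.1
  have h10 := laplacian_eq_trace b ((extChartAt (𝓡 n) x).map_source hz.1) (f := f)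
    (by rw [h9]; exact hz.2)
  rw [h9] at h10
  exact h10.symm

/-- A bound for the norm of the Hessian passes to limits. -/
theorem abs_hess_le_of_frequently {f : M → ℝ} {x : M} (hf : ContMDiffAt (𝓡 n) 𝓘(ℝ, ℝ) 2 f x)
    {m : ℝ} (h : ∃ᶠ z in 𝓝 x, ∀ u v, |hessWithin n univ f z u v| ≤ m * (‖u‖ * ‖v‖))
    (u v : TangentSpace (𝓡 n) x) : |hessWithin n univ f x u v| ≤ m * (‖u‖ * ‖v‖) := by
  have hy : extChartAt (𝓡 n) x x ∈ (extChartAt (𝓡 n) x).target := mem_extChartAt_target x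
  have hxx := (extChartAt (𝓡 n) x).left_inv (mem_extChartAt_source x)
  have hf' : ContMDiffAt (𝓡 n) 𝓘(ℝ, ℝ) 2 f
    ((extChartAt (𝓡 n) x).symm (extChartAt (𝓡 n) x x)) := by rwa [hxx]
  set a := coords n x u
  set b := coords n x v
  have hn : ∀ y c, ‖(coords n ((extChartAt (𝓡 n) x).symm y)).symm (frame n x y c)‖
      = √(chartG n x y c c) := by
    intro y c
    rw [chartG_apply, metricAt_self, Real.sqrt_sq (norm_nonneg _)]
  have h1 : ContinuousAt (fun y => |chartHess f x y a b|) (extChartAt (𝓡 n) x x) :=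
    (continuousAt_chartHess hy hf' a b).abs
  have h2 : ContinuousAt (fun y => m * (√(chartG n x y a a) * √(chartG n x y b b)))
      (extChartAt (𝓡 n) x x) :=
    ((continuousAt_chartG hy a a).sqrt.mul (continuousAt_chartG hy b b).sqrt).const_mul m
  have key : ∀ y ∈ (extChartAt (𝓡 n) x).target,
      ContMDiffAt (𝓡 n) 𝓘(ℝ, ℝ) 2 f ((extChartAt (𝓡 n) x).symm y) →
      (∀ u v, |hessWithin n univ f ((extChartAt (𝓡 n) x).symm y) u v| ≤ m * (‖u‖ * ‖v‖)) →
      |chartHess f x y a b| ≤ m * (√(chartG n x y a a) * √(chartG n x y b b)) := by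
    intro y hy hfy hb
    have := hb ((coords n _).symm (frame n x y a)) ((coords n _).symm (frame n x y b))
    rwa [hess_eq_chartHess hy hfy, hn, hn] at this
  have h3 : |chartHess f x (extChartAt (𝓡 n) x x) a b|
      ≤ m * (√(chartG n x (extChartAt (𝓡 n) x x) a a)
        * √(chartG n x (extChartAt (𝓡 n) x x) b b)) := by
    -- A strict violation at x would persist nearby, against the frequent validity of the bound.
    by_contra hlt
    push Not at hlt
    refine h ?_
    filter_upwards [(continuousAt_extChartAt (I := 𝓡 n) x).eventually (h2.eventually_lt h1 hlt),
      extChartAt_source_mem_nhds (I := 𝓡 n) x,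
      (contMDiffAt_iff_contMDiffAt_nhds (by simp)).1 hf] with z hz hzs hfz hb
    have h7 := (extChartAt (𝓡 n) x).left_inv hzs
    refine absurd (key _ ((extChartAt (𝓡 n) x).map_source hzs) ?_ ?_) (not_le.2 hz)
    · rwa [h7]
    · rwa [h7]
  rw [chartG_self, chartG_self, metricAt_self, metricAt_self, Real.sqrt_sq (norm_nonneg _),
    Real.sqrt_sq (norm_nonneg _)] at h3
  rw [hessWithin_univ_eq, christoffel_eq]
  have h9 : chartGrad f x (extChartAt (𝓡 n) x x) = coords n x (gradWithin n univ f x) := by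
    have := frame_chartGrad hy (hf'.mdifferentiableAt (by simp))
    rw [frame_self, hxx] at this
    exact this
  rw [chartHess, h9] at h3
  exact h3

end HessForm

end MinGraph

end

noncomputable section

namespace MinGraph

/-! ### Derivatives within a set -/

section Within

variable {E : Type*} [NormedAddCommGroup E] [NormedSpace ℝ E] {S : Set E} {y : E} {F D : E → ℝ}
  {ψ : ℝ → ℝ}

theorem hasFDerivAt_comp_real (hD : DifferentiableAt ℝ D y) (hψ : Differentiable ℝ ψ) :
    HasFDerivAt (fun z => ψ (D z)) (deriv ψ (D y) • fderiv ℝ D y) y :=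
  (hψ (D y)).hasDerivAt.comp_hasFDerivAt y hD.hasFDerivAt

theorem fderivWithin_add_comp (hS : UniqueDiffWithinAt ℝ S y) (hF : DifferentiableWithinAt ℝ F S y)
    (hD : DifferentiableAt ℝ D y) (hψ : Differentiable ℝ ψ) :
    fderivWithin ℝ (fun z => F z + ψ (D z)) S y
      = fderivWithin ℝ F S y + deriv ψ (D y) • fderiv ℝ D y :=
  (hF.hasFDerivWithinAt.fun_add (hasFDerivAt_comp_real hD hψ).hasFDerivWithinAt).fderivWithin hS

/-- F has derivatives only within S while D is C² near y. Unique differentiability at all points of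
S makes the first-order formula hold along S near y, so it can be differentiated once more. -/
theorem fderivWithin_fderivWithin_add_comp (hS : UniqueDiffOn ℝ S) (hy : y ∈ S)
    (hF : ContDiffWithinAt ℝ 2 F S y) (hD : ContDiffAt ℝ 2 D y) (hψ : ContDiff ℝ 2 ψ) (u v : E) :
    fderivWithin ℝ (fderivWithin ℝ (fun z => F z + ψ (D z)) S) S y u v
      = fderivWithin ℝ (fderivWithin ℝ F S) S y u v
        + deriv ψ (D y) * fderiv ℝ (fderiv ℝ D) y u v
        + deriv (deriv ψ) (D y) * (fderiv ℝ D y u * fderiv ℝ D y v) := by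
  have hψ1 : Differentiable ℝ ψ := hψ.differentiable (by simp)
  have hψ2 : Differentiable ℝ (deriv ψ) :=
    ((contDiff_succ_iff_deriv (n := 1)).1 hψ).2.2.differentiable (by simp)
  have h1 : fderivWithin ℝ (fun z => F z + ψ (D z)) S =ᶠ[𝓝[S] y]
      fun z => fderivWithin ℝ F S z + deriv ψ (D z) • fderiv ℝ D z := by
    have h2 := hF.eventually (by simp)
    rw [insert_eq_of_mem hy] at h2
    filter_upwards [h2, self_mem_nhdsWithin,
      (hD.eventually (by simp)).filter_mono nhdsWithin_le_nhds] with z hz hzS hDz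
    exact fderivWithin_add_comp (hS z hzS) (hz.differentiableWithinAt (by simp))
      (hDz.differentiableAt (by simp)) hψ1
  have h3 := ((hF.fderivWithin_right (m := 1) hS (by norm_num) hy).differentiableWithinAt
    (by simp)).hasFDerivWithinAt
  have h4 := ((hD.fderiv_right (m := 1) (by norm_num)).differentiableAt (by simp)).hasFDerivAt
  have h5 := (hasFDerivAt_comp_real (hD.differentiableAt (by simp)) hψ2).fun_smul h4
  rw [h1.fderivWithin_eq (h1.self_of_nhdsWithin hy),
    (h3.fun_add h5.hasFDerivWithinAt).fderivWithin (hS y hy)]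
  simp
  ring

/-- The nonnegative side of the zero set of a submersion is a set of unique differentiability. -/
theorem uniqueDiffWithinAt_of_pos (hF : DifferentiableAt ℝ F y) (h0 : F y = 0)
    (hne : fderiv ℝ F y ≠ 0) (hS : ∀ᶠ z in 𝓝 y, 0 < F z → z ∈ S) :
    UniqueDiffWithinAt ℝ S y := by
  have hmem : ∀ v, 0 < fderiv ℝ F y v → ∀ᶠ t : ℝ in 𝓝[>] 0, y + t • v ∈ S := by
    intro v hv
    have hc : HasDerivAt (fun t : ℝ => y + t • v) v 0 := by
      simpa using ((hasDerivAt_id (0 : ℝ)).smul_const v).const_add y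
    have hc0 : Tendsto (fun t : ℝ => y + t • v) (𝓝 0) (𝓝 y) := by
      simpa [ContinuousAt] using hc.continuousAt
    have h1 : HasDerivAt (fun t : ℝ => F (y + t • v)) (fderiv ℝ F y v) 0 := by
      refine HasFDerivAt.comp_hasDerivAt (l := F) (0 : ℝ) ?_ hc
      simpa using hF.hasFDerivAt
    have h2 := ((hasDerivAt_iff_tendsto_slope.1 h1).eventually (lt_mem_nhds hv)).filter_mono
      (nhdsWithin_mono _ fun t (ht : (0 : ℝ) < t) => ht.ne')
    filter_upwards [h2, self_mem_nhdsWithin, (hc0.eventually hS).filter_mono nhdsWithin_le_nhds]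
      with t ht ht0 htS
    refine htS ?_
    simp only [slope_def_field, sub_zero, zero_smul, add_zero, h0] at ht
    exact (div_pos_iff_of_pos_right ht0).1 ht
  -- The tangent cone contains the open half-space on which dF is positive, and a half-space spans.
  have hcone : ∀ v, 0 < fderiv ℝ F y v → v ∈ tangentConeAt ℝ S y := fun v hv =>
    mem_tangentConeAt_of_add_smul_mem (l := 𝓝[>] (0 : ℝ)) (c := fun t : ℝ => t)
      (tendsto_id.mono_left (nhdsWithin_mono _ fun t (ht : (0 : ℝ) < t) => ht.ne')) (hmem v hv)
  obtain ⟨v, hv⟩ : ∃ v, 0 < fderiv ℝ F y v := by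
    obtain ⟨v, hv⟩ := DFunLike.ne_iff.1 hne
    rcases lt_or_gt_of_ne hv with h | h
    · exact ⟨-v, by simpa using h⟩
    · exact ⟨v, by simpa using h⟩
  refine ⟨?_, ?_⟩
  · have : (Submodule.span ℝ (tangentConeAt ℝ S y) : Set E) = univ := by
      refine eq_univ_of_forall fun u => ?_
      -- Large enough for dF(u + kv) = dF(u) + 1 + |dF(u)| to be positive.
      set k : ℝ := (1 + |fderiv ℝ F y u|) / fderiv ℝ F y v with hk
      have h1 : 0 < fderiv ℝ F y (u + k • v) := by
        rw [map_add, map_smul, smul_eq_mul, hk, div_mul_cancel₀ _ hv.ne']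
        linarith [neg_abs_le (fderiv ℝ F y u)]
      have h2 : u = (u + k • v) - k • v := by abel
      rw [h2]
      exact Submodule.sub_mem _ (Submodule.subset_span (hcone _ h1))
        (Submodule.smul_mem _ _ (Submodule.subset_span (hcone _ hv)))
    rw [this]
    exact dense_univ
  · refine mem_closure_of_frequently_of_tendsto (f := fun t : ℝ => y + t • v) (b := 𝓝[>] 0)
      (hmem v hv).frequently ?_
    have : ContinuousAt (fun t : ℝ => y + t • v) 0 := by fun_prop
    simpa [ContinuousAt] using this.mono_left nhdsWithin_le_nhds

end Within

/-! ### Gradient and Hessian of φ + ψ∘d within the closed domain -/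

section Manifold

variable {n : ℕ} {M : Type*} [MetricSpace M] [ChartedSpace (EuclideanSpace ℝ (Fin n)) M]

theorem mvfderivWithin_eq_chart {s : Set M} {f : M → ℝ} {x : M}
    (hf : MDifferentiableWithinAt (𝓡 n) 𝓘(ℝ, ℝ) f s x) (u : TangentSpace (𝓡 n) x) :
    mvfderivWithin (𝓡 n) f s x u = fderivWithin ℝ (fun y => f ((extChartAt (𝓡 n) x).symm y))
      ((extChartAt (𝓡 n) x).symm ⁻¹' s ∩ range (𝓡 n)) (extChartAt (𝓡 n) x x) (coords n x u) := by
  have h := hf.mfderivWithin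
  exact DFunLike.congr_fun h u

theorem IsC2Domain.uniqueMDiffOn [IsManifold (𝓡 n) ∞ M] {Ω : Set M} (hΩ : IsC2Domain n Ω) :
    UniqueMDiffOn (𝓡 n) (closure Ω) := by
  intro x hx
  by_cases hxΩ : x ∈ Ω
  · exact (hΩ.isOpen.uniqueMDiffWithinAt hxΩ).mono subset_closure
  obtain ⟨f, hf⟩ := hΩ.exists_defining x ⟨hx, by rwa [hΩ.isOpen.interior_eq]⟩
  have hy : extChartAt (𝓡 n) x x ∈ (extChartAt (𝓡 n) x).target := mem_extChartAt_target x
  have hxx := (extChartAt (𝓡 n) x).left_inv (mem_extChartAt_source x)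
  have hd : MDifferentiableAt (𝓡 n) 𝓘(ℝ, ℝ) f x := hf.contMDiffAt.mdifferentiableAt (by simp)
  refine uniqueDiffWithinAt_of_pos (F := fun y => f ((extChartAt (𝓡 n) x).symm y)) ?_ ?_ ?_ ?_
  · exact (contDiffAt_comp_symm (n := n) (k := 2) two_le_infty hy
      (by rw [hxx]; exact hf.contMDiffAt)).differentiableAt (by simp)
  · simp only [hxx, hf.map_eq_zero]
  · intro h
    refine hf.deriv_ne_zero ?_
    ext u
    rw [← mvfderivWithin_univ, mvfderivWithin_eq_chart hd.mdifferentiableWithinAt]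
    simp only [preimage_univ, univ_inter, modelWithCornersSelf_coe, range_id, fderivWithin_univ, h]
    rfl
  · have hc := continuousAt_extChartAt_symm (I := 𝓡 n) x
    rw [ContinuousAt, hxx] at hc
    filter_upwards [hc.eventually hf.mem_iff] with y hy hpos
    exact ⟨subset_closure (hy.2 hpos), by simp⟩

variable [RiemannianBundle (fun x : M => TangentSpace (𝓡 n) x)] [IsManifold (𝓡 n) ∞ M]
  {s : Set M} {φ d : M → ℝ} {ψ : ℝ → ℝ} {x : M}

/-- The trace of `s` in the preferred chart around `x`. -/
theorem chart_set_eventuallyEq (s : Set M) (x : M) :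
    ((extChartAt (𝓡 n) x).symm ⁻¹' s ∩ range (𝓡 n) : Set (Model n))
      =ᶠ[𝓝 (extChartAt (𝓡 n) x x)]
      ((extChartAt (𝓡 n) x).target ∩ (extChartAt (𝓡 n) x).symm ⁻¹' s : Set (Model n)) := by
  filter_upwards [extChartAt_target_mem_nhds_self n x] with y hy
  simp only [modelWithCornersSelf_coe, range_id, inter_univ]
  exact propext ⟨fun h => ⟨hy, h⟩, fun h => h.2⟩

theorem gradWithin_add_comp (hs : UniqueMDiffOn (𝓡 n) s) (hx : x ∈ s)
    (hφ : MDifferentiableWithinAt (𝓡 n) 𝓘(ℝ, ℝ) φ s x) (hd : MDifferentiableAt (𝓡 n) 𝓘(ℝ, ℝ) d x)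
    (hψ : Differentiable ℝ ψ) :
    gradWithin n s (fun z => φ z + ψ (d z)) x
      = gradWithin n s φ x + deriv ψ (d x) • gradWithin n univ d x := by
  have hxx := (extChartAt (𝓡 n) x).left_inv (mem_extChartAt_source x)
  have hψd : MDifferentiableAt (𝓡 n) 𝓘(ℝ, ℝ) (fun z => ψ (d z)) x :=
    MDifferentiableAt.comp (g := ψ) x (hψ (d x)).mdifferentiableAt hd
  have hw : MDifferentiableWithinAt (𝓡 n) 𝓘(ℝ, ℝ) (fun z => φ z + ψ (d z)) s x :=
    hφ.add hψd.mdifferentiableWithinAt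
  refine ext_inner_right ℝ fun u => ?_
  rw [inner_add_left, real_inner_smul_left, inner_gradWithin, inner_gradWithin, inner_grad,
    ← mvfderivWithin_univ, mvfderivWithin_eq_chart hw, mvfderivWithin_eq_chart hφ,
    mvfderivWithin_eq_chart hd.mdifferentiableWithinAt]
  simp only [preimage_univ, univ_inter, modelWithCornersSelf_coe, range_id, fderivWithin_univ,
    inter_univ]
  have hS := hs x hx
  have hF := hφ.differentiableWithinAt_writtenInExtChartAt
  have hD := hd.differentiableWithinAt_writtenInExtChartAt
  simp only [UniqueMDiffWithinAt, modelWithCornersSelf_coe, range_id, inter_univ] at hS hF hD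
  have key := fderivWithin_add_comp hS hF (hD.differentiableAt univ_mem) hψ
  have key2 := DFunLike.congr_fun key (coords n x u)
  simp only [writtenInExtChartAt, Function.comp_def, hxx] at key2
  exact key2

variable [IsContMDiffRiemannianBundle (𝓡 n) ∞ (EuclideanSpace ℝ (Fin n))
      (fun x : M => TangentSpace (𝓡 n) x)]

/-- The set in the definition of `hessWithin` includes junk points outside the chart target.
Intersecting with the target does not change the germ at the base point, and unique
differentiability is available for the smaller set. -/
theorem fderivWithin_fderivWithin_chart (s : Set M) (x : M) (F : Model n → ℝ) :
    fderivWithin ℝ (fderivWithin ℝ F ((extChartAt (𝓡 n) x).symm ⁻¹' s ∩ range (𝓡 n)))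
      ((extChartAt (𝓡 n) x).symm ⁻¹' s ∩ range (𝓡 n)) (extChartAt (𝓡 n) x x)
    = fderivWithin ℝ (fderivWithin ℝ F ((extChartAt (𝓡 n) x).target ∩
        (extChartAt (𝓡 n) x).symm ⁻¹' s))
      ((extChartAt (𝓡 n) x).target ∩ (extChartAt (𝓡 n) x).symm ⁻¹' s) (extChartAt (𝓡 n) x x) := by
  rw [(fderivWithin_eventually_congr_set (chart_set_eventuallyEq s x)).fderivWithin_eq_of_nhds,
    fderivWithin_congr_set (chart_set_eventuallyEq s x)]

theorem hessWithin_add_comp (hs : UniqueMDiffOn (𝓡 n) s) (hx : x ∈ s)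
    (hφ : ContMDiffWithinAt (𝓡 n) 𝓘(ℝ, ℝ) 2 φ s x) (hd : ContMDiffAt (𝓡 n) 𝓘(ℝ, ℝ) 2 d x)
    (hψ : ContDiff ℝ 2 ψ) (u v : TangentSpace (𝓡 n) x) :
    hessWithin n s (fun z => φ z + ψ (d z)) x u v
      = hessWithin n s φ x u v + deriv ψ (d x) * hessWithin n univ d x u v
        + deriv (deriv ψ) (d x) * (⟪gradWithin n univ d x, u⟫ * ⟪gradWithin n univ d x, v⟫) := by
  have hy : extChartAt (𝓡 n) x x ∈ (extChartAt (𝓡 n) x).target := mem_extChartAt_target x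
  have hxx := (extChartAt (𝓡 n) x).left_inv (mem_extChartAt_source x)
  have hd1 := hd.mdifferentiableAt (by simp)
  have hD : ContDiffAt ℝ 2 (fun y => d ((extChartAt (𝓡 n) x).symm y)) (extChartAt (𝓡 n) x x) :=
    contDiffAt_comp_symm two_le_infty hy (by rwa [hxx])
  have hF : ContDiffWithinAt ℝ 2 (fun y => φ ((extChartAt (𝓡 n) x).symm y))
      ((extChartAt (𝓡 n) x).target ∩ (extChartAt (𝓡 n) x).symm ⁻¹' s) (extChartAt (𝓡 n) x x) :=
    (contMDiffWithinAt_iff.1 hφ).2.mono fun y hy => ⟨hy.2, by simp⟩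
  have hdu : ∀ u : TangentSpace (𝓡 n) x, fderiv ℝ (fun y => d ((extChartAt (𝓡 n) x).symm y))
      (extChartAt (𝓡 n) x x) (coords n x u) = ⟪gradWithin n univ d x, u⟫ := by
    intro u
    rw [fderiv_comp_symm hy (by rwa [hxx]), hxx, frame_self]
    rfl
  have key := fderivWithin_fderivWithin_add_comp (hs.uniqueDiffOn_target_inter x)
    ⟨hy, by rw [mem_preimage, hxx]; exact hx⟩ hF hD hψ (coords n x u) (coords n x v)
  rw [hdu, hdu] at key
  simp only [hxx] at key
  have hg := gradWithin_add_comp hs hx (hφ.mdifferentiableWithinAt (by simp)) hd1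
    (hψ.differentiable (by simp))
  rw [hessWithin_univ_eq]
  simp only [hessWithin, christoffel_eq, fderivWithin_fderivWithin_chart]
  rw [hg, map_add, map_smul, christoffelForm_add_third, christoffelForm_smul_third]
  simp only [Function.comp_def]
  rw [key]
  ring

end Manifold

end MinGraph

end

noncomputable section

namespace MinGraph

/-! ### Traces of bilinear forms and a unit normal -/

section Trace

variable {E : Type*} [NormedAddCommGroup E] [InnerProductSpace ℝ E]

theorem sum_orthonormalBasis_eq {ι κ : Type*} [Fintype ι] [Fintype κ]
    (e : OrthonormalBasis ι ℝ E) (b : OrthonormalBasis κ ℝ E) (B : E →ₗ[ℝ] E →ₗ[ℝ] ℝ) :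
    ∑ i, B (e i) (e i) = ∑ k, B (b k) (b k) := by
  classical
  rw [sum_orthonormalBasis_eq_trace e b.toBasis, sum_orthonormalBasis_eq_trace b b.toBasis]

/-- A bilinear form that is nonnegative on the orthogonal complement of a unit vector `N` has trace
at least `B N N`. -/
theorem apply_self_le_sum_orthonormalBasis [FiniteDimensional ℝ E] {ι : Type*} [Fintype ι]
    (e : OrthonormalBasis ι ℝ E) (B : E →ₗ[ℝ] E →ₗ[ℝ] ℝ) {N : E} (hN : ‖N‖ = 1)
    (hB : ∀ v, ⟪N, v⟫ = 0 → 0 ≤ B v v) : B N N ≤ ∑ i, B (e i) (e i) := by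
  classical
  have h1 : Orthonormal ℝ ((↑) : ({N} : Set E) → E) := by
    rw [orthonormal_subtype_iff_ite]
    rintro v rfl w rfl
    simp [hN]
  obtain ⟨u, b, hu, hb⟩ := h1.exists_orthonormalBasis_extension
  have hNu : N ∈ u := by simpa using hu
  rw [sum_orthonormalBasis_eq e b]
  have hbN : b ⟨N, hNu⟩ = N := by rw [hb]
  -- Subtracting B(N, N) at the index of N makes every summand nonnegative, whatever the sign of
  -- B(N, N).
  have h2 := Finset.single_le_sum (f := fun i => B (b i) (b i) - if i = ⟨N, hNu⟩ then B N N else 0)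
    (s := Finset.univ) ?_ (Finset.mem_univ ⟨N, hNu⟩)
  · simp [hbN, Finset.sum_sub_distrib] at h2
    exact h2
  · intro i _
    by_cases hi : i = ⟨N, hNu⟩
    · simp [hi, hbN]
    · simp only [hi, if_false, sub_zero]
      refine hB _ ?_
      rw [← hbN]
      exact b.orthonormal.2 (Ne.symm hi)

end Trace

/-! ### Mean curvature of distance spheres and the touching principle -/

section Curvature

variable {n : ℕ} {M : Type*} [MetricSpace M] [ChartedSpace (EuclideanSpace ℝ (Fin n)) M]
  [RiemannianBundle (fun x : M => TangentSpace (𝓡 n) x)] [IsManifold (𝓡 n) ∞ M]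
  [IsContMDiffRiemannianBundle (𝓡 n) ∞ (EuclideanSpace ℝ (Fin n))
      (fun x : M => TangentSpace (𝓡 n) x)]

theorem finrank_tangentSpace (x : M) : Module.finrank ℝ (TangentSpace (𝓡 n) x) = n :=
  finrank_euclideanSpace_fin (𝕜 := ℝ) (n := n)

theorem abs_hess_le {s : Set M} {f : M → ℝ} {x : M} {m : ℝ≥0∞} (hm : m ≠ ⊤)
    (h : hessNormWithin n s f x ≤ m) (u v : TangentSpace (𝓡 n) x) :
    |hessWithin n s f x u v| ≤ m.toReal * (‖u‖ * ‖v‖) := by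
  have h1 : ∀ u v : TangentSpace (𝓡 n) x, ‖u‖ ≤ 1 → ‖v‖ ≤ 1 →
      |hessWithin n s f x u v| ≤ m.toReal := by
    intro u v hu hv
    have h2 : ‖hessWithin n s f x u v‖ₑ ≤ m := by
      refine le_trans ?_ h
      exact le_iSup₂_of_le u hu (le_iSup₂_of_le v hv le_rfl)
    have h3 := ENNReal.toReal_mono hm h2
    rwa [toReal_enorm, Real.norm_eq_abs] at h3
  rcases eq_or_ne u 0 with rfl | hu
  · rw [← hessForm_apply]; simp
  rcases eq_or_ne v 0 with rfl | hv
  · rw [← hessForm_apply]; simp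
  have hu' := norm_pos_iff.2 hu
  have hv' := norm_pos_iff.2 hv
  have h4 := h1 (‖u‖⁻¹ • u) (‖v‖⁻¹ • v) (by rw [norm_smul]; simp [hu'.ne'])
    (by rw [norm_smul]; simp [hv'.ne'])
  rw [← hessForm_apply, map_smul, map_smul, LinearMap.smul_apply, smul_eq_mul, smul_eq_mul,
    hessForm_apply, abs_mul, abs_mul, abs_inv, abs_inv, abs_norm, abs_norm] at h4
  field_simp at h4
  linarith

theorem abs_laplacian_le {s : Set M} {f : M → ℝ} {x : M} {m : ℝ≥0∞} (hm : m ≠ ⊤)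
    (h : hessNormWithin n s f x ≤ m) : |laplacianWithin n s f x| ≤ n * m.toReal := by
  refine (Finset.abs_sum_le_sum_abs _ _).trans ?_
  refine (Finset.sum_le_card_nsmul _ _ m.toReal fun i _ => ?_).trans ?_
  · have := abs_hess_le hm h (stdOrthonormalBasis ℝ (TangentSpace (𝓡 n) x) i)
      (stdOrthonormalBasis ℝ (TangentSpace (𝓡 n) x) i)
    rwa [OrthonormalBasis.norm_eq_one, mul_one, mul_one] at this
  · simp [finrank_tangentSpace]

variable [IsRiemannianManifold (𝓡 n) M] {p x : M}

/-- As |∇d| = 1 and ∇²d(∇d, ∇d) = 0, neither the normalization nor the normal term contributes. -/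
theorem levelMeanCurvature_sphereDist (r : ℝ) (hx : edist x p < injRadius n p) (hne : x ≠ p) :
    levelMeanCurvature n (sphereDist p r) x
      = -(laplacianWithin n univ (sphereDist p r) x) / (n - 1) := by
  have h := norm_grad_sphereDist r hx hne
  simp only [levelMeanCurvature, h, inv_one, one_smul, mul_one, hess_sphereDist_grad r hx hne,
    sub_zero]
  ring

/-- A geodesic sphere which touches from outside a domain at a boundary point of negative mean
curvature has negative mean curvature there. -/
theorem laplacian_sphereDist_pos (hn : 2 ≤ n) {Ω : Set M} {r : ℝ} {f : M → ℝ}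
    (hf : IsDefiningAt n Ω x f) (hneg : levelMeanCurvature n f x < 0)
    (hdisj : Disjoint (Metric.closedBall p r) Ω) (hxs : x ∈ Metric.sphere p r)
    (htan : ∀ v : TangentSpace (𝓡 n) x,
      mvfderiv (𝓡 n) f x v = 0 ↔ mvfderiv (𝓡 n) (sphereDist p r) x v = 0)
    (hx : edist x p < injRadius n p) (hne : x ≠ p) :
    0 < laplacianWithin n univ (sphereDist p r) x := by
  have hy : extChartAt (𝓡 n) x x ∈ (extChartAt (𝓡 n) x).target := mem_extChartAt_target x
  have hxx := (extChartAt (𝓡 n) x).left_inv (mem_extChartAt_source x)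
  have hd := contMDiffAt_sphereDist n r hx hne
  have hchart : ∀ {g : M → ℝ}, ContMDiffAt (𝓡 n) 𝓘(ℝ, ℝ) 2 g x →
      ContDiffAt ℝ 2 (fun y => g ((extChartAt (𝓡 n) x).symm y)) (extChartAt (𝓡 n) x x) ∧
      ∀ v, fderiv ℝ (fun y => g ((extChartAt (𝓡 n) x).symm y)) (extChartAt (𝓡 n) x x) v
        = mvfderiv (𝓡 n) g x ((coords n x).symm v) := by
    intro g hg
    refine ⟨contDiffAt_comp_symm two_le_infty hy (by rwa [hxx]), fun v => ?_⟩
    rw [fderiv_comp_symm hy (by rw [hxx]; exact hg.mdifferentiableAt (by simp)), hxx, frame_self,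
      ← inner_grad]
    rfl
  obtain ⟨hF, hDF⟩ := hchart hf.contMDiffAt
  obtain ⟨hD, hDD⟩ := hchart hd
  have hc := continuousAt_extChartAt_symm (I := 𝓡 n) x
  rw [ContinuousAt, hxx] at hc
  obtain ⟨k, hk, hkD, hcomp⟩ := second_deriv_comparison hF hD (by simp only [hxx, hf.map_eq_zero])
    (by
      simp only [hxx, sphereDist]
      rw [Metric.mem_sphere.1 hxs, sub_self])
    (by
      filter_upwards [hc.eventually hf.mem_iff] with y hy hpos
      have h1 := hy.2 hpos
      have h2 : (extChartAt (𝓡 n) x).symm y ∉ Metric.closedBall p r :=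
        fun h => disjoint_left.1 hdisj h h1
      rw [Metric.mem_closedBall, not_le] at h2
      exact sub_nonneg.2 h2.le)
    (fun v => by rw [hDF, hDD, htan])
    (by
      intro h
      refine hf.deriv_ne_zero (ContinuousLinearMap.ext fun u => ?_)
      have := hDF (coords n x u)
      rw [h] at this
      exact this.symm)
  have hgrad : gradWithin n univ (sphereDist p r) x = k • gradWithin n univ f x := by
    refine ext_inner_right ℝ fun u => ?_
    rw [real_inner_smul_left, inner_grad, inner_grad]
    have h1 := hDF (coords n x u)
    have h2 := hDD (coords n x u)
    rw [hkD, smul_apply, h1, smul_eq_mul] at h2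
    exact h2.symm
  set N := gradWithin n univ (sphereDist p r) x with hN
  have hN1 : ‖N‖ = 1 := norm_grad_sphereDist r hx hne
  set g := gradWithin n univ f x with hg
  have hkg : k * ‖g‖ = 1 := by rw [← hN1, hgrad, norm_smul, Real.norm_of_nonneg hk.le]
  have hgpos : 0 < ‖g‖ := by
    by_contra hcon
    have : ‖g‖ = 0 := le_antisymm (not_lt.1 hcon) (norm_nonneg _)
    rw [this] at hkg
    simp at hkg
  have hunit : ‖g‖⁻¹ • g = N := by rw [hgrad, inv_eq_of_mul_eq_one_left hkg]
  have hf0 : 0 < laplacianWithin n univ f x - hessWithin n univ f x N N := by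
    simp only [levelMeanCurvature, ← hg, hunit] at hneg
    have hn1 : (1 : ℝ) < n := by exact_mod_cast hn
    have hcoef : -1 / (((n : ℝ) - 1) * ‖g‖) < 0 :=
      div_neg_of_neg_of_pos (by norm_num) (mul_pos (by linarith) hgpos)
    exact pos_of_mul_neg_right hneg hcoef.le
  -- On the tangent space of the sphere this form is nonnegative by the comparison. The Christoffel
  -- terms cancel since ∇d = k∇f. Its trace is at least B(N, N) = -k∇²f(N, N), that is, Δd ≥ k(Δf -
  -- ∇²f(N, N)), which is positive by the sign of the curvature.
  set B := hessForm (n := n) univ (sphereDist p r) x - k • hessForm (n := n) univ f x with hB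
  have hcomp' : ∀ v : TangentSpace (𝓡 n) x, ⟪N, v⟫ = 0 →
      0 ≤ B v v := by
    intro v hv
    have h1 : fderiv ℝ (fun y => f ((extChartAt (𝓡 n) x).symm y)) (extChartAt (𝓡 n) x x)
        (coords n x v) = 0 := by
      rw [hDF, ContinuousLinearEquiv.symm_apply_apply, htan, ← inner_grad]
      exact hv
    have h2 := hcomp _ h1
    simp only [hB, LinearMap.sub_apply, LinearMap.smul_apply, hessForm_apply, smul_eq_mul]
    rw [hessWithin_univ_eq, hessWithin_univ_eq, ← hN, ← hg, hgrad, christoffel_eq, christoffel_eq,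
      map_smul, christoffelForm_smul_third]
    linarith
  have key := apply_self_le_sum_orthonormalBasis
    (stdOrthonormalBasis ℝ (TangentSpace (𝓡 n) x)) B hN1 hcomp'
  simp only [hB, LinearMap.sub_apply, LinearMap.smul_apply, hessForm_apply, smul_eq_mul,
    Finset.sum_sub_distrib, ← Finset.mul_sum] at key
  rw [hN, hess_sphereDist_grad r hx hne, ← hN] at key
  have h3 := mul_pos hk hf0
  simp only [laplacianWithin] at h3 ⊢
  linarith

end Curvature

end MinGraph

end

noncomputable section

namespace MinGraph

/-! ### The one-variable profile ψ -/

section Psi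

variable {ϱ σ s : ℝ}

theorem contDiff_psiOf (ϱ σ : ℝ) : ContDiff ℝ 2 (psiOf ϱ σ) := by
  unfold psiOf
  fun_prop

theorem deriv_psiOf (hσ : σ ≠ 0) (s : ℝ) :
    deriv (psiOf ϱ σ) s = (ϱ - (ϱ - σ) * Real.exp (σ * s)) / σ := by
  have h1 : HasDerivAt (fun s : ℝ => σ * s) σ s := by
    simpa using (hasDerivAt_id s).const_mul σ
  have h2 : HasDerivAt (fun s : ℝ => ϱ * s) ϱ s := by
    simpa using (hasDerivAt_id s).const_mul ϱ
  have h3 : HasDerivAt (psiOf ϱ σ)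
      (1 / σ * (ϱ + (σ - ϱ) / σ * (Real.exp (σ * s) * σ))) s :=
    (h2.add ((h1.exp.sub_const 1).const_mul ((σ - ϱ) / σ))).const_mul (1 / σ)
  rw [h3.deriv]
  field_simp
  ring

theorem deriv_deriv_psiOf (hσ : σ ≠ 0) (s : ℝ) :
    deriv (deriv (psiOf ϱ σ)) s = σ * deriv (psiOf ϱ σ) s - ϱ := by
  have h1 : HasDerivAt (fun s : ℝ => σ * s) σ s := by
    simpa using (hasDerivAt_id s).const_mul σ
  have h2 : HasDerivAt (fun s => (ϱ - (ϱ - σ) * Real.exp (σ * s)) / σ)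
      (-((ϱ - σ) * (Real.exp (σ * s) * σ)) / σ) s :=
    ((h1.exp.const_mul (ϱ - σ)).const_sub ϱ).div_const σ
  rw [funext (deriv_psiOf (ϱ := ϱ) hσ), h2.deriv]
  field_simp
  ring

theorem psiOf_zero : psiOf ϱ σ 0 = 0 := by simp [psiOf]

/-- For σ < 0 the derivative of ψ decreases from the value 1 at s = 0, and the bound on s is exactly
its zero, the point where e^{σs} = ϱ/(ϱ - σ). -/
theorem deriv_psiOf_nonneg (hϱ : 0 < ϱ) (hσ : σ < 0)
    (hs : s ≤ 1 / σ * Real.log (ϱ / (ϱ - σ))) :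
    0 ≤ deriv (psiOf ϱ σ) s := by
  have hpos : 0 < ϱ - σ := by linarith
  rw [deriv_psiOf hσ.ne]
  refine div_nonneg_of_nonpos ?_ hσ.le
  have h1 : Real.log (ϱ / (ϱ - σ)) ≤ σ * s := by
    have := mul_le_mul_of_nonpos_left hs hσ.le
    rwa [← mul_assoc, mul_one_div, div_self hσ.ne, one_mul] at this
  rw [Real.log_le_iff_le_exp (div_pos hϱ hpos), div_le_iff₀' hpos] at h1
  linarith

theorem deriv_psiOf_le_one (hϱ : 0 < ϱ) (hσ : σ < 0) (hs : 0 ≤ s) :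
    deriv (psiOf ϱ σ) s ≤ 1 := by
  have hpos : 0 < ϱ - σ := by linarith
  rw [deriv_psiOf hσ.ne, div_le_one_of_neg hσ]
  have h1 : Real.exp (σ * s) ≤ 1 := Real.exp_le_one_iff.2 (mul_nonpos_of_nonpos_of_nonneg hσ.le hs)
  nlinarith

theorem psiOf_nonneg (hϱ : 0 < ϱ) (hσ : σ < 0) (hs0 : 0 ≤ s)
    (hs : s ≤ 1 / σ * Real.log (ϱ / (ϱ - σ))) : 0 ≤ psiOf ϱ σ s := by
  have hd := (contDiff_psiOf ϱ σ).differentiable (by simp)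
  have h1 : MonotoneOn (psiOf ϱ σ) (Icc 0 s) := by
    refine monotoneOn_of_deriv_nonneg (convex_Icc 0 s) hd.continuous.continuousOn
      hd.differentiableOn fun t ht => ?_
    rw [interior_Icc] at ht
    exact deriv_psiOf_nonneg hϱ hσ (ht.2.le.trans hs)
  rw [← psiOf_zero (ϱ := ϱ) (σ := σ)]
  exact h1 (left_mem_Icc.2 hs0) (right_mem_Icc.2 hs0) hs0

end Psi

/-! ### The pointwise inequality behind the constants -/

section Bounds

theorem rhoOf_mul_thetaOf {n : ℕ} {τ lam μ : ℝ} (hτ : 0 < τ) :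
    rhoOf τ * thetaOf n τ lam μ = 2 * τ ^ 3 + 4 * τ ^ 2 + 3 * τ
      - (τ ^ 2 + 2 * τ + 2) * ((n - 1) * lam) + τ ^ 2 * μ := by
  have h : rhoOf τ ≠ 0 := by unfold rhoOf; positivity
  simp only [thetaOf]
  field_simp
  ring

/-- The sign of the minimal surface operator at a point, from the bounds for the second derivatives
of `φ` and of the distance function; `a` and `b` are the derivatives of `ψ`, `W` is `|∇w|²`. -/
theorem minimalOp_bound {τ L μ σ a b W q Δφ Δd A B : ℝ} (hτ : 0 < τ) (hL : 0 ≤ L)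
    (ha0 : 0 ≤ a) (ha1 : a ≤ 1)
    (hσ : σ = -(4 * τ ^ 2 + 2 * τ) - (τ ^ 2 + 2 * τ + 2) * L - τ ^ 2 * μ)
    (hb : b = σ * a - rhoOf τ) (hb0 : b ≤ 0) (hW0 : 0 ≤ W) (hW : W ≤ (τ + a) ^ 2) (hq : q ≤ W)
    (hΔφ : Δφ ≤ τ) (hΔd : Δd ≤ L) (hA : -(τ * W) ≤ A) (hB : -(μ * τ ^ 2) ≤ B) :
    (1 + W) * (Δφ + a * Δd + b) - (A + a * B + b * q) ≤ 0 := by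
  have h1 : (1 + W) * Δφ ≤ (1 + W) * τ := mul_le_mul_of_nonneg_left hΔφ (by linarith)
  have h2 : (1 + W) * (a * Δd) ≤ (1 + W) * (a * L) :=
    mul_le_mul_of_nonneg_left (mul_le_mul_of_nonneg_left hΔd ha0) (by linarith)
  have h3 : -(a * B) ≤ a * (μ * τ ^ 2) := by nlinarith
  -- The normal term of the Hessian cannot consume more than |W|² of the factor 1 + |W|², so one
  -- full copy of b ≤ 0 survives.
  have h4 : b * (1 + W - q) ≤ b := by nlinarith
  have h5 : W * τ ≤ (τ + a) ^ 2 * τ := mul_le_mul_of_nonneg_right hW hτ.le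
  have haL : 0 ≤ a * L := mul_nonneg ha0 hL
  have h6 : W * (a * L) ≤ (τ + a) ^ 2 * (a * L) := mul_le_mul_of_nonneg_right hW haL
  -- Here a ≤ 1 turns (τ + a)² into τ² + 2τ + 1, giving the coefficient τ² + 2τ + 2 of L in σ.
  have h7 : (τ + a) ^ 2 * (a * L) ≤ (τ ^ 2 + 2 * τ + 1) * (a * L) :=
    mul_le_mul_of_nonneg_right (by nlinarith) haL
  -- With a² ≤ a, the two contributions τ(τ + a)² from Δφ and ∇²φ sum to at most 2τ³ + a(4τ² + 2τ).
  have h8 : a * a * τ ≤ a * τ := mul_le_mul_of_nonneg_right (by nlinarith) hτ.le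
  have h9 : b = -(a * (4 * τ ^ 2 + 2 * τ)) - (τ ^ 2 + 2 * τ + 2) * (a * L) - a * (μ * τ ^ 2)
      - (τ + 2 * τ ^ 3) := by
    rw [hb, hσ, rhoOf]; ring
  nlinarith

end Bounds

end MinGraph

end

noncomputable section

namespace MinGraph

/-! ### Bounds from the geometric hypotheses, and 𝓜(φ + ψ∘d) -/

section Constants

variable {n : ℕ} {M : Type*} [MetricSpace M] [ChartedSpace (EuclideanSpace ℝ (Fin n)) M]
  [RiemannianBundle (fun x : M => TangentSpace (𝓡 n) x)] {Ω : Set M} {φ : M → ℝ} {x : M}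

theorem abs_laplacian_le_tauOf (hτ : tauOf n Ω φ ≠ ⊤) (hx : x ∈ closure Ω) :
    |laplacianWithin n (closure Ω) φ x| ≤ (tauOf n Ω φ).toReal := by
  have h : ‖laplacianWithin n (closure Ω) φ x‖ₑ ≤ tauOf n Ω φ :=
    le_max_of_le_left (le_iSup₂_of_le x hx le_rfl)
  have h2 := ENNReal.toReal_mono hτ h
  rwa [toReal_enorm, Real.norm_eq_abs] at h2

theorem norm_grad_le_tauOf (hτ : tauOf n Ω φ ≠ ⊤) (hx : x ∈ closure Ω) :
    ‖gradWithin n (closure Ω) φ x‖ ≤ (tauOf n Ω φ).toReal := by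
  have h : ‖gradWithin n (closure Ω) φ x‖ₑ ≤ tauOf n Ω φ :=
    le_max_of_le_right (le_max_of_le_left (le_iSup₂_of_le x hx le_rfl))
  have h2 := ENNReal.toReal_mono hτ h
  rwa [toReal_enorm] at h2

theorem hessNorm_le_tauOf (hx : x ∈ closure Ω) :
    hessNormWithin n (closure Ω) φ x ≤ tauOf n Ω φ :=
  le_max_of_le_right (le_max_of_le_right (le_iSup₂_of_le x hx le_rfl))

variable {r : ℝ} {c : M → M} {p : M}

theorem maxHessSphere_le_muR (hp : p ∈ negBoundary n Ω) :
    maxHessSphere n (c p) r ≤ muR n Ω r c :=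
  le_iSup₂_of_le (f := fun p (_ : p ∈ negBoundary n Ω) => maxHessSphere n (c p) r) p hp le_rfl

theorem radiusR_le_injRadius (hp : p ∈ negBoundary n Ω) :
    radiusR n Ω c ≤ injRadius n (c p) :=
  iInf₂_le_of_le p hp le_rfl

theorem ExteriorSphere.edist_lt (hes : ExteriorSphere n Ω r c) (hp : p ∈ negBoundary n Ω) :
    edist p (c p) < radiusR n Ω c := by
  rw [edist_dist, Metric.mem_sphere.1 (hes.mem_sphere p hp)]
  exact hes.lt_radius

theorem ExteriorSphere.ne_center (hes : ExteriorSphere n Ω r c) (hr : 0 < r)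
    (hp : p ∈ negBoundary n Ω) : p ≠ c p := by
  have h := Metric.mem_sphere.1 (hes.mem_sphere p hp)
  exact dist_pos.1 (h ▸ hr)

variable [IsManifold (𝓡 n) ∞ M] [IsContMDiffRiemannianBundle (𝓡 n) ∞ (EuclideanSpace ℝ (Fin n))
      (fun x : M => TangentSpace (𝓡 n) x)] [IsRiemannianManifold (𝓡 n) M]

/-- Since Δd(p) = -(n-1)H(p), this is H(p) ≥ λ, once λ is known to be a real number. -/
theorem ExteriorSphere.laplacian_le (hes : ExteriorSphere n Ω r c) (hn : 2 ≤ n) (hr : 0 < r)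
    (hμ : muR n Ω r c ≠ ⊤) (hp : p ∈ negBoundary n Ω) :
    laplacianWithin n univ (sphereDist (c p) r) p ≤ -((n - 1) * (lambdaR n Ω r c).toReal) := by
  have hn1 : (0 : ℝ) < n - 1 := by
    have : (1 : ℝ) < n := by exact_mod_cast hn
    linarith
  have hlev : ∀ q ∈ negBoundary n Ω, levelMeanCurvature n (sphereDist (c q) r) q
      = -(laplacianWithin n univ (sphereDist (c q) r) q) / (n - 1) := fun q hq =>
    levelMeanCurvature_sphereDist r ((hes.edist_lt hq).trans_le (radiusR_le_injRadius hq))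
      (hes.ne_center hr hq)
  have h1 : lambdaR n Ω r c ≤ (levelMeanCurvature n (sphereDist (c p) r) p : EReal) :=
    iInf₂_le_of_le p hp le_rfl
  -- Finiteness of λ: |Δd| ≤ nμ at the contact points bounds the curvatures below, so `toReal`
  -- returns the true value.
  have h2 : ((-(n * (muR n Ω r c).toReal) / (n - 1) : ℝ) : EReal) ≤ lambdaR n Ω r c := by
    refine le_iInf₂ fun q hq => EReal.coe_le_coe_iff.2 ?_
    rw [hlev q hq]
    have h3 : hessNormWithin n univ (sphereDist (c q) r) q ≤ muR n Ω r c :=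
      (le_iSup₂_of_le (f := fun y (_ : y ∈ Metric.sphere (c q) r) =>
        hessNormWithin n univ (sphereDist (c q) r) y) q (hes.mem_sphere q hq) le_rfl).trans
        (maxHessSphere_le_muR hq)
    have h4 := (le_abs_self _).trans (abs_laplacian_le hμ h3)
    exact div_le_div_of_nonneg_right (neg_le_neg h4) hn1.le
  have h5 : (lambdaR n Ω r c).toReal ≤ levelMeanCurvature n (sphereDist (c p) r) p := by
    rw [← EReal.coe_le_coe_iff, EReal.coe_toReal (ne_top_of_le_ne_top (EReal.coe_ne_top _) h1)
      (ne_bot_of_le_ne_bot (EReal.coe_ne_bot _) h2)]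
    exact h1
  rw [hlev p hp, le_div_iff₀ hn1] at h5
  linarith

/-- A nonempty closure contains a point of the set itself, where the curvature is strictly negative;
limit points would only give weak inequalities. One such point suffices for the sign of L. -/
theorem ExteriorSphere.exists_laplacian_pos (hes : ExteriorSphere n Ω r c) (hn : 2 ≤ n)
    (hr : 0 < r) : ∃ q ∈ negBoundary n Ω, 0 < laplacianWithin n univ (sphereDist (c q) r) q := by
  obtain ⟨q, hq⟩ := closure_nonempty_iff.1 hes.nonempty
  have hq' : q ∈ negBoundary n Ω := subset_closure hq
  obtain ⟨-, f, hf, hneg⟩ := hq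
  exact ⟨q, hq', laplacian_sphereDist_pos hn hf hneg (hes.exterior q hq') (hes.mem_sphere q hq')
    (hes.tangent q hq' f hf) ((hes.edist_lt hq').trans_le (radiusR_le_injRadius hq'))
    (hes.ne_center hr hq')⟩

/-- The bounds of the locally Hadamard condition extend to the closure of the domain. -/
theorem LocallyHadamardES.laplacian_le_of_mem_closure (hes : LocallyHadamardES n Ω r c) (hn : 2 ≤ n)
    (hr : 0 < r) (hμ : muR n Ω r c ≠ ⊤) (hp : p ∈ negBoundary n Ω) (hx : x ∈ closure Ω)
    (hxR : edist x (c p) < radiusR n Ω c) (hne : x ≠ c p) :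
    laplacianWithin n univ (sphereDist (c p) r) x ≤ -((n - 1) * (lambdaR n Ω r c).toReal) ∧
    ∀ u v, |hessWithin n univ (sphereDist (c p) r) x u v|
      ≤ (muR n Ω r c).toReal * (‖u‖ * ‖v‖) := by
  have hn1 : (0 : ℝ) < n - 1 := by
    have : (1 : ℝ) < n := by exact_mod_cast hn
    linarith
  have hinj := radiusR_le_injRadius (c := c) hp
  have hd := contMDiffAt_sphereDist n r (hxR.trans_le hinj) hne
  have hev : ∀ᶠ z in 𝓝 x, edist z (c p) < radiusR n Ω c ∧ z ≠ c p :=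
    ((continuous_id.edist continuous_const).continuousAt.eventually (gt_mem_nhds hxR)).and
      (isOpen_ne.eventually_mem hne)
  have hfr : ∃ᶠ z in 𝓝 x, z ∈ Ω ∧ edist z (c p) < radiusR n Ω c ∧ z ≠ c p :=
    (mem_closure_iff_frequently.1 hx).and_eventually hev
  refine ⟨?_, abs_hess_le_of_frequently hd (hfr.mono fun z hz => ?_)⟩
  -- At points z of Ω the curvature condition reads Δd(z) ≤ Δd(p), and Δd(p) ≤ L; continuity carries
  -- this to x.
  · refine le_of_tendsto_of_frequently (continuousAt_laplacian hd) (hfr.mono fun z hz => ?_)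
    refine le_trans ?_ (hes.toExteriorSphere.laplacian_le hn hr hμ hp)
    have h1 := hes.meanCurvature_le p hp z hz.1 hz.2.1
    rw [levelMeanCurvature_sphereDist r ((hes.edist_lt hp).trans_le hinj) (hes.ne_center hr hp),
      levelMeanCurvature_sphereDist r (hz.2.1.trans_le hinj) hz.2.2,
      div_le_div_iff_of_pos_right hn1] at h1
    linarith
  · exact abs_hess_le hμ ((hes.hess_le p hp z hz.1 hz.2.1).trans (maxHessSphere_le_muR hp))

/-- The minimal surface operator on `φ + ψ ∘ d`, where `d` is the distance function to a sphere. -/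
theorem minimalOp_add_comp_sphereDist {s : Set M} {p : M} {ψ : ℝ → ℝ}
    (hs : UniqueMDiffOn (𝓡 n) s) (hxs : x ∈ s) (hφ : ContMDiffWithinAt (𝓡 n) 𝓘(ℝ, ℝ) 2 φ s x)
    (hx : edist x p < injRadius n p) (hne : x ≠ p) (hψ : ContDiff ℝ 2 ψ) :
    ∃ W : TangentSpace (𝓡 n) x,
      ‖W‖ ≤ ‖gradWithin n s φ x‖ + |deriv ψ (sphereDist p r x)| ∧
      minimalOp n s (fun z => φ z + ψ (sphereDist p r z)) x
        = (1 + ‖W‖ ^ 2) * (laplacianWithin n s φ x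
            + deriv ψ (sphereDist p r x) * laplacianWithin n univ (sphereDist p r) x
            + deriv (deriv ψ) (sphereDist p r x))
          - (hessWithin n s φ x W W
            + deriv ψ (sphereDist p r x) * hessWithin n univ (sphereDist p r) x
                (gradWithin n s φ x) (gradWithin n s φ x)
            + deriv (deriv ψ) (sphereDist p r x) *
              ⟪gradWithin n univ (sphereDist p r) x, W⟫ ^ 2) := by
  have hd := contMDiffAt_sphereDist n r hx hne
  have hH := hessWithin_add_comp hs hxs hφ hd hψ
  have hG := gradWithin_add_comp hs hxs (hφ.mdifferentiableWithinAt (by simp))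
    (hd.mdifferentiableAt (by simp)) (hψ.differentiable (by simp))
  set a := deriv ψ (sphereDist p r x) with ha
  set b := deriv (deriv ψ) (sphereDist p r x) with hb
  set N := gradWithin n univ (sphereDist p r) x with hN
  have hN1 : ‖N‖ = 1 := norm_grad_sphereDist r hx hne
  set G := gradWithin n s φ x with hGdef
  refine ⟨G + a • N, ?_, ?_⟩
  · refine (norm_add_le _ _).trans ?_
    rw [norm_smul, hN1, mul_one, Real.norm_eq_abs]
  · have hlap : laplacianWithin n s (fun z => φ z + ψ (sphereDist p r z)) x
        = laplacianWithin n s φ x + a * laplacianWithin n univ (sphereDist p r) x + b := by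
      -- Parseval for the unit vector N: the term ψ''(d) dd⊗dd has trace ψ''(d).
      have h1 : ∑ i, ⟪N, stdOrthonormalBasis ℝ (TangentSpace (𝓡 n) x) i⟫
          * ⟪N, stdOrthonormalBasis ℝ (TangentSpace (𝓡 n) x) i⟫ = 1 := by
        have := (stdOrthonormalBasis ℝ (TangentSpace (𝓡 n) x)).sum_inner_mul_inner N N
        rw [real_inner_self_eq_norm_sq, hN1] at this
        simp only [real_inner_comm N] at this ⊢
        simpa [sq] using this
      simp only [laplacianWithin, hH, Finset.sum_add_distrib, ← Finset.mul_sum, h1, mul_one]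
    -- Only ∇φ survives in ∇²d(∇w, ∇w), since ∇²d annihilates N; hence the bound μτ² without any
    -- power of a.
    have hHN : hessWithin n univ (sphereDist p r) x (G + a • N) (G + a • N)
        = hessWithin n univ (sphereDist p r) x G G := by
      have e1 := hess_sphereDist_grad r hx hne
      have e2 := hess_grad_sphereDist r hx hne
      simp only [← hN, ← hessForm_apply] at e1 e2 ⊢
      simp only [map_add, map_smul, LinearMap.add_apply, LinearMap.smul_apply, e1, e2, smul_zero,
        add_zero]
    rw [minimalOp, hG, hlap, hH, hHN]
    ring

end Constants

end MinGraph

end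

/-! ### Assembly of the barrier -/

theorem proposition5 {n : ℕ} (hn : 2 ≤ n) {M : Type*} [MetricSpace M] [CompleteSpace M]
    [ChartedSpace (EuclideanSpace ℝ (Fin n)) M] [IsManifold (𝓡 n) ∞ M]
    [RiemannianBundle (fun x : M => TangentSpace (𝓡 n) x)]
    [IsContMDiffRiemannianBundle (𝓡 n) ∞ (EuclideanSpace ℝ (Fin n))
      (fun x : M => TangentSpace (𝓡 n) x)]
    [IsRiemannianManifold (𝓡 n) M]
    {Ω : Set M} (hΩ : MinGraph.IsC2Domain n Ω)
    {r : ℝ} (hr : 0 < r) {c : M → M} (hes : MinGraph.LocallyHadamardES n Ω r c)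
    {φ : M → ℝ} (hφ : ContMDiffOn (𝓡 n) 𝓘(ℝ, ℝ) 2 φ (closure Ω))
    (hτ0 : MinGraph.tauOf n Ω φ ≠ 0) (hτ : MinGraph.tauOf n Ω φ ≠ ⊤)
    (hμ : MinGraph.muR n Ω r c ≠ ⊤)
    {ϱ θ σ δ : ℝ}
    (hϱ : ϱ = MinGraph.rhoOf (MinGraph.tauOf n Ω φ).toReal)
    (hθ : θ = MinGraph.thetaOf n (MinGraph.tauOf n Ω φ).toReal
      (MinGraph.lambdaR n Ω r c).toReal (MinGraph.muR n Ω r c).toReal)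
    (hσ : σ = ϱ * (1 - θ))
    (hδR : ENNReal.ofReal (r + δ) < MinGraph.radiusR n Ω c)
    (hδ : δ < 1 / σ * Real.log (ϱ / (ϱ - σ)))
    {p : M} (hp : p ∈ MinGraph.negBoundary n Ω)
    {w : M → ℝ}
    (hw : ∀ x, w x = φ x + MinGraph.psiOf ϱ σ (MinGraph.sphereDist (c p) r x)) :
    (∀ s : ℝ, deriv (deriv (MinGraph.psiOf ϱ σ)) s - σ * deriv (MinGraph.psiOf ϱ σ) s + ϱ = 0) ∧
    ContMDiffOn (𝓡 n) 𝓘(ℝ, ℝ) 2 w (closure (Metric.ball (c p) (r + δ) ∩ Ω)) ∧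
    w p = φ p ∧
    ∀ x ∈ closure (Metric.ball (c p) (r + δ) ∩ Ω),
      φ x ≤ w x ∧ MinGraph.minimalOp n (closure Ω) w x ≤ 0 := by
  open MinGraph in
  obtain rfl : w = fun x => φ x + psiOf ϱ σ (sphereDist (c p) r x) := funext hw
  set τ := (tauOf n Ω φ).toReal with hτdef
  set μ := (muR n Ω r c).toReal with hμdef
  set L := -((n - 1) * (lambdaR n Ω r c).toReal) with hL
  have hτpos : 0 < τ := ENNReal.toReal_pos hτ0 hτ
  have hμ0 : 0 ≤ μ := ENNReal.toReal_nonneg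
  -- Δd > 0 at one contact point, and L bounds Δd at all of them.
  have hL0 : 0 ≤ L := by
    obtain ⟨q, hq, hlap⟩ := hes.exists_laplacian_pos hn hr
    exact hlap.le.trans (hes.toExteriorSphere.laplacian_le hn hr hμ hq)
  have hϱpos : 0 < ϱ := by rw [hϱ, rhoOf]; positivity
  -- The term ϱ = τ + 2τ³ in σ = ϱ - ϱθ cancels the cubic part of ϱθ and leaves -2τ from the linear
  -- part.
  have hσeq : σ = -(4 * τ ^ 2 + 2 * τ) - (τ ^ 2 + 2 * τ + 2) * L - τ ^ 2 * μ := by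
    have h := rhoOf_mul_thetaOf (n := n) (lam := (lambdaR n Ω r c).toReal) (μ := μ) hτpos
    rw [hσ, mul_sub, mul_one, hθ, hϱ, h, rhoOf, hL]
    ring
  have hσneg : σ < 0 := by
    have : 0 ≤ (τ ^ 2 + 2 * τ + 2) * L := by positivity
    have : 0 ≤ τ ^ 2 * μ := by positivity
    have : 0 < 4 * τ ^ 2 + 2 * τ := by positivity
    linarith
  have hmem : ∀ x ∈ closure (Metric.ball (c p) (r + δ) ∩ Ω), x ∈ closure Ω ∧
      edist x (c p) < radiusR n Ω c ∧ x ≠ c p ∧ 0 ≤ sphereDist (c p) r x ∧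
      sphereDist (c p) r x ≤ δ := by
    intro x hx
    have h1 : x ∈ closure Ω := closure_mono inter_subset_right hx
    have h2 : dist x (c p) ≤ r + δ :=
      Metric.closure_ball_subset_closedBall (closure_mono inter_subset_left hx)
    -- Points of Ω lie outside the closed exterior ball; this inequality is closed and extends to
    -- the closure, keeping x away from the centre.
    have h3 : r ≤ dist x (c p) := by
      refine closure_minimal (t := {z | r ≤ dist z (c p)}) (fun z hz => ?_)
        (isClosed_le continuous_const (continuous_id.dist continuous_const)) h1
      have h4 : z ∉ Metric.closedBall (c p) r :=
        fun h => disjoint_left.1 (hes.exterior p hp) h hz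
      rw [Metric.mem_closedBall, not_le] at h4
      exact h4.le
    refine ⟨h1, ?_, dist_pos.1 (hr.trans_le h3), sub_nonneg.2 h3, ?_⟩
    · rw [edist_dist]
      exact (ENNReal.ofReal_le_ofReal h2).trans_lt hδR
    · rw [sphereDist]; linarith
  have hinj := radiusR_le_injRadius (c := c) hp
  refine ⟨fun s => ?_, fun x hx => ?_, ?_, fun x hx => ?_⟩
  · rw [deriv_deriv_psiOf hσneg.ne]; ring
  · obtain ⟨h1, h2, h3, -⟩ := hmem x hx
    have hd := contMDiffAt_sphereDist n r (h2.trans_le hinj) h3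
    have hψd : ContMDiffAt (𝓡 n) 𝓘(ℝ, ℝ) 2 (fun z => psiOf ϱ σ (sphereDist (c p) r z)) x :=
      (contDiff_psiOf ϱ σ).contMDiff.contMDiffAt.comp x hd
    exact ((hφ x h1).mono (closure_mono inter_subset_right)).add hψd.contMDiffWithinAt
  · have : sphereDist (c p) r p = 0 := by
      rw [sphereDist, Metric.mem_sphere.1 (hes.mem_sphere p hp), sub_self]
    simp only [this, psiOf_zero, add_zero]
  · obtain ⟨h1, h2, h3, h4, h5⟩ := hmem x hx
    have h6 := h5.trans hδ.le
    refine ⟨le_add_of_nonneg_right (psiOf_nonneg hϱpos hσneg h4 h6), ?_⟩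
    have ha0 := deriv_psiOf_nonneg hϱpos hσneg h6
    have ha1 := deriv_psiOf_le_one hϱpos hσneg h4
    obtain ⟨hΔ, hH⟩ := hes.laplacian_le_of_mem_closure hn hr hμ hp h1 h2 h3
    obtain ⟨W, hW, hM⟩ := minimalOp_add_comp_sphereDist (r := r) hΩ.uniqueMDiffOn h1 (hφ x h1)
      (h2.trans_le hinj) h3 (contDiff_psiOf ϱ σ)
    rw [hM]
    have hG := norm_grad_le_tauOf hτ h1
    have hN := norm_grad_sphereDist r (h2.trans_le hinj) h3
    have hWτ : ‖W‖ ≤ τ + deriv (psiOf ϱ σ) (sphereDist (c p) r x) := by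
      rw [abs_of_nonneg ha0] at hW
      linarith
    have hψ2 := deriv_deriv_psiOf (ϱ := ϱ) hσneg.ne (sphereDist (c p) r x)
    refine minimalOp_bound hτpos hL0 ha0 ha1 hσeq (by rw [hψ2, hϱ]) ?_ (sq_nonneg _)
      (pow_le_pow_left₀ (norm_nonneg _) hWτ 2) ?_
      ((le_abs_self _).trans (abs_laplacian_le_tauOf hτ h1))
      hΔ ?_ ?_
    -- b = σa - ϱ with σ < 0, a ≥ 0 and ϱ > 0.
    · rw [hψ2]
      nlinarith
    · have h7 := abs_real_inner_le_norm (gradWithin n univ (sphereDist (c p) r) x) W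
      rw [hN, one_mul] at h7
      rw [← sq_abs]
      exact pow_le_pow_left₀ (abs_nonneg _) h7 2
    · have h7 := (abs_le.1 (abs_hess_le hτ (hessNorm_le_tauOf h1) W W)).1
      rwa [← sq] at h7
    · have h7 := (abs_le.1 (hH (gradWithin n (closure Ω) φ x) (gradWithin n (closure Ω) φ x))).1
      rw [← sq] at h7
      have h8 := mul_le_mul_of_nonneg_left (pow_le_pow_left₀ (norm_nonneg _) hG 2) hμ0
      linarith
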